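/- Let $\ell$ be a prime number and let $K$ be a complete discrete valuation field of characteristic zero and residue characteristic $\ell$, with valuation ring $\mathcal{O}_K$ and normalized valuation $v : K^\times \twoheadrightarrow \mathbf{Z}$; put $e = v(\ell)$. Let $G$ be a finite group satisfying $(D_\ell)$, that is, $G$ has a normal subgroup $N$ of order prime to $\ell$ such that $G/N$ is a cyclic $\ell$-group, and suppose that the group algebra $K[N]$ is quasisplit, i.e. semisimple and isomorphic to a direct sum of matrix algebras over commutative fields. Let $V$ be a $2d$-dimensional $K$-vector space which is a faithful simple symplectic $K[G]$-module: $G$ acts $K$-linearly and faithfully on $V$, $V$ is simple as a $K[G]$-module, and there is a nondegenerate alternating $G$-invariant $K$-bilinear form $V \times V \to K$. Suppose $\ell > de + 1$. Then there exist a $G$-stable $\mathcal{O}_K$-lattice $T$ in $V$ and a perfect alternating $G$-invariant $\mathcal{O}_K$-bilinear form $$f' : T \times T \to \mathcal{O}_K,$$ where perfect means that both natural maps $T \to \mathrm{Hom}_{\mathcal{O}_K}(T, \mathcal{O}_K)$ induced by $f'$ are bijective. -/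

import Mathlib

open scoped WithZero

/-- The finite group `G` satisfies the condition `(D_ℓ)` by way of its normal subgroup `N`: `ℓ` is a
prime number, `N` has order prime to `ℓ`, and `G ⧸ N` is a cyclic `ℓ`-group. -/
structure SatisfiesDVia (ℓ : ℕ) (G : Type*) [Group G] (N : Subgroup G) [N.Normal] : Prop where
  prime : ℓ.Prime
  finite : Finite G
  coprime : (Nat.card N).Coprime ℓ
  isCyclic : IsCyclic (G ⧸ N)
  isPGroup : IsPGroup ℓ (G ⧸ N)

/-- A semisimple `K`-algebra is quasisplit if it is a (finite) direct sum of matrix algebras over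
commutative fields. (These fields are isomorphic to the centres of the simple blocks of `A`, so it
is no restriction to take them in the universe of `A`.) -/
def IsQuasisplit.{u, w} (K : Type u) [Field K] (A : Type w) [Ring A] [Algebra K A] : Prop :=
  IsSemisimpleRing A ∧
    ∃ (n : ℕ) (F : Fin n → Type w) (d : Fin n → ℕ) (_ : ∀ i, Field (F i))
      (_ : ∀ i, Algebra K (F i)),
      (∀ i, NeZero (d i)) ∧ Nonempty (A ≃ₐ[K] Π i, Matrix (Fin (d i)) (Fin (d i)) (F i))

/-- The representation `ρ` makes `V` a symplectic `K[G]`-module: there is a nondegenerate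
alternating `G`-invariant `K`-bilinear form on `V`. -/
def IsSymplecticRep {K G V : Type*} [Field K] [Group G] [AddCommGroup V] [Module K V]
    (ρ : Representation K G V) : Prop :=
  ∃ f : LinearMap.BilinForm K V, f.Nondegenerate ∧ f.IsAlt ∧
    ∀ (g : G) (x y : V), f (ρ g x) (ρ g y) = f x y

/-! The aim is a stable lattice that is its own dual for an invariant alternating form. Since `e ≥
1`, the bound on `ℓ` makes `ℓ` odd and prime to `2 d = dim V`, and Clifford theory then leaves two
cases. As `G / N` is an `ℓ`-group, `V` lies over a single block of `K[N]`, a matrix algebra over a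
field `F`. A generator of `G / N` acts trivially on `F`, so by Skolem–Noether it acts on the block
as an inner automorphism; comparing the two yields a `G`-endomorphism of `ℓ`-power order. If it is
`1`, then `V` is irreducible over `N`; otherwise a power of it has order `ℓ` (`restrict_or_exists`).

If `V` is irreducible over `N`, whose order is invertible in the valuation ring, then the reduction
of a stable lattice `T` is irreducible: a projection modulo the uniformizer is averaged over `N` and
lifted to an idempotent. So all stable lattices are multiples of `T`, the dual lattice is one of
them, and rescaling the form makes `T` self-dual.

Suppose now that some `ζ` of order `ℓ` commutes with `G`. By Schur `K[ζ]` is a field, and the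
product of the `1 - ζ ^ i` for `0 < i < ℓ` is `ℓ`. Taking determinants, `w (ℓ - 1) = 2 d e` for the
valuation `w` of `det (1 - ζ)`, and `ℓ > d e + 1` forces `w = 1`. Hence `V` is a line over `K[ζ]`,
so `G` is commutative. For `σ` in `G` of order `ℓ`, the operator `u = σ - σ⁻¹` is skew-adjoint with
a uniformizer as determinant, and the lattices stable under `u` form one chain `u ^ i T`. The dual
of `T` is some `u ^ c T`. For `c = 2 s` the lattice `u ^ s T` is self-dual; for odd `c` the form
would induce a nonzero alternating form on the residue line `T / u T`, which is impossible
(`exists_perfect_of_skewAdjoint`). -/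

open scoped Pointwise Polynomial

/-! ### Schur's lemma, and Clifford theory for a normal subgroup of `ℓ`-power index. -/

namespace Representation

variable {K G V : Type*} [Field K] [Group G] [AddCommGroup V] [Module K V]

/-- A representation on a nonzero space is irreducible iff each stable subspace is trivial. -/
theorem isIrreducible_iff_forall_stable (ρ : Representation K G V) :
    ρ.IsIrreducible ↔ Nontrivial V ∧ ∀ W : Submodule K V, (∀ g, ∀ x ∈ W, ρ g x ∈ W) →
      W = ⊥ ∨ W = ⊤ := by
  constructor
  · intro h
    refine ⟨?_, fun W hW ↦ ?_⟩
    · by_contra hV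
      rw [not_nontrivial_iff_subsingleton] at hV
      obtain ⟨a, b, hab⟩ := h.exists_pair_ne
      exact hab (Subrepresentation.toSubmodule_injective (Subsingleton.elim _ _))
    · let W' : Subrepresentation ρ := ⟨W, fun g x hx ↦ hW g x hx⟩
      rcases h.eq_bot_or_eq_top W' with h | h
      · left; exact congrArg Subrepresentation.toSubmodule h
      · right; exact congrArg Subrepresentation.toSubmodule h
  · rintro ⟨hV, h⟩
    refine { exists_pair_ne := ⟨⊥, ⊤, fun hb ↦ ?_⟩, eq_bot_or_eq_top := fun W ↦ ?_ }
    · have := congrArg Subrepresentation.toSubmodule hb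
      exact bot_ne_top (α := Submodule K V) this
    · rcases h W.toSubmodule (fun g x hx ↦ W.apply_mem_toSubmodule g hx) with h | h
      · left; exact Subrepresentation.toSubmodule_injective h
      · right; exact Subrepresentation.toSubmodule_injective h

variable {ρ : Representation K G V}

/-- Schur's lemma. -/
theorem IsIrreducible.eq_zero_or_isUnit (h : ρ.IsIrreducible) {x : Module.End K V}
    (hx : ∀ g, Commute x (ρ g)) : x = 0 ∨ IsUnit x := by
  obtain ⟨_, h⟩ := (isIrreducible_iff_forall_stable ρ).1 h
  have hx' : ∀ g v, x (ρ g v) = ρ g (x v) := fun g v ↦ LinearMap.congr_fun (hx g) v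
  rcases h (LinearMap.ker x) (fun g v hv ↦ by
    rw [LinearMap.mem_ker] at hv ⊢; rw [hx', hv, map_zero]) with hk | hk
  · rcases h (LinearMap.range x) (by
      rintro g _ ⟨v, rfl⟩
      exact ⟨ρ g v, hx' g v⟩) with hr | hr
    · exact Or.inl (LinearMap.range_eq_bot.1 hr)
    · exact Or.inr ((Module.End.isUnit_iff x).2
        ⟨LinearMap.ker_eq_bot.1 hk, LinearMap.range_eq_top.1 hr⟩)
  · exact Or.inl (LinearMap.ker_eq_top.1 hk)

theorem IsIrreducible.eq_zero_of_mul_eq_zero (h : ρ.IsIrreducible) {x y : Module.End K V}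
    (hx : ∀ g, Commute x (ρ g)) (hxy : x * y = 0) : x = 0 ∨ y = 0 := by
  rcases h.eq_zero_or_isUnit hx with h | h
  · exact Or.inl h
  · exact Or.inr (h.mul_right_eq_zero.1 hxy)

theorem IsIrreducible.eq_zero_or_eq_one (h : ρ.IsIrreducible) {x : Module.End K V}
    (hx : ∀ g, Commute x (ρ g)) (hi : IsIdempotentElem x) : x = 0 ∨ x = 1 := by
  rcases h.eq_zero_of_mul_eq_zero hx (y := x - 1) (by rw [mul_sub, hi.eq, mul_one, sub_self])
    with h | h
  · exact Or.inl h
  · exact Or.inr (sub_eq_zero.1 h)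

/-- The action of the group on endomorphisms by conjugation. -/
@[reducible] def conjAction (ρ : Representation K G V) : MulSemiringAction G (Module.End K V) where
  smul g x := ρ g * x * ρ g⁻¹
  one_smul x := by change ρ 1 * x * ρ 1⁻¹ = x; simp
  mul_smul g h x := by
    change ρ (g * h) * x * ρ (g * h)⁻¹ = ρ g * (ρ h * x * ρ h⁻¹) * ρ g⁻¹
    simp [mul_assoc]
  smul_zero g := by change ρ g * 0 * ρ g⁻¹ = 0; simp
  smul_add g x y := by
    change ρ g * (x + y) * ρ g⁻¹ = ρ g * x * ρ g⁻¹ + ρ g * y * ρ g⁻¹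
    simp [mul_add, add_mul]
  smul_one g := by
    change ρ g * 1 * ρ g⁻¹ = 1
    rw [mul_one, ← map_mul, mul_inv_cancel, map_one]
  smul_mul g x y := by
    change ρ g * (x * y) * ρ g⁻¹ = ρ g * x * ρ g⁻¹ * (ρ g * y * ρ g⁻¹)
    have : ρ g⁻¹ * ρ g = 1 := by rw [← map_mul, inv_mul_cancel, map_one]
    simp only [mul_assoc]
    rw [← mul_assoc (ρ g⁻¹) (ρ g), this, one_mul]

theorem apply_mul_apply_inv (ρ : Representation K G V) (g : G) : ρ g * ρ g⁻¹ = 1 := by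
  rw [← map_mul, mul_inv_cancel, map_one]

theorem apply_inv_mul_apply (ρ : Representation K G V) (g : G) : ρ g⁻¹ * ρ g = 1 := by
  rw [← map_mul, inv_mul_cancel, map_one]

theorem conj_eq_self_iff (ρ : Representation K G V) (g : G) (x : Module.End K V) :
    ρ g * x * ρ g⁻¹ = x ↔ Commute x (ρ g) := by
  constructor
  · intro h
    have := congrArg (· * ρ g) h
    simp only [mul_assoc, apply_inv_mul_apply, mul_one] at this
    exact this.symm
  · intro h
    rw [← h.eq, mul_assoc, apply_mul_apply_inv, mul_one]

/-- Let `A` be a `G`-stable algebra of endomorphisms containing the image of a normal subgroup `N`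
whose index is a power of a prime `ℓ` not dividing the dimension of the irreducible representation.
Then the centre of `A` has no idempotents except `0` and `1`. -/
theorem IsIrreducible.central_idempotent_eq_zero_or_one [CharZero K] [FiniteDimensional K V]
    [Finite G] (h : ρ.IsIrreducible) (N : Subgroup G) {ℓ m : ℕ} (hℓ : ℓ.Prime)
    (hind : N.index = ℓ ^ m) (hdim : ¬ ℓ ∣ Module.finrank K V)
    (A : Subalgebra K (Module.End K V)) (hA : ∀ g, ∀ x ∈ A, ρ g * x * ρ g⁻¹ ∈ A)
    (hNA : ∀ n ∈ N, ρ n ∈ A) {u : Module.End K V} (huA : u ∈ A) (hu : ∀ x ∈ A, Commute u x)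
    (hi : IsIdempotentElem u) : u = 0 ∨ u = 1 := by
  classical
  let _ := ρ.conjAction
  have smul_def : ∀ (g : G) (x : Module.End K V), g • x = ρ g * x * ρ g⁻¹ := fun _ _ ↦ rfl
  obtain ⟨hnt, -⟩ := (isIrreducible_iff_forall_stable ρ).1 h
  -- `G` permutes the nonzero central idempotents. The orbit of one of least rank consists of
  -- orthogonal idempotents with sum `1`, so its size divides both the dimension and `ℓ ^ m`. It is
  -- therefore `1`, and the least rank is already the full dimension.
  let P : Module.End K V → Prop :=
    fun u ↦ u ∈ A ∧ (∀ x ∈ A, Commute u x) ∧ IsIdempotentElem u ∧ u ≠ 0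
  have hPsmul : ∀ (g : G) x, P x → P (g • x) := by
    rintro g x ⟨h1, h2, h3, h4⟩
    refine ⟨hA g x h1, fun y hy ↦ ?_, ?_, ?_⟩
    · have := h2 _ (hA g⁻¹ y hy)
      have h5 : g • (x * (g⁻¹ • y)) = g • ((g⁻¹ • y) * x) := congrArg (g • ·) this
      rwa [smul_mul', smul_mul', smul_inv_smul] at h5
    · change g • x * g • x = g • x
      rw [← smul_mul', h3.eq]
    · rwa [Ne, smul_eq_zero_iff_eq]
  let R : Module.End K V → ℕ := fun u ↦ Module.finrank K (LinearMap.range u)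
  -- In characteristic zero the trace determines the rank of an idempotent; this makes the rank
  -- invariant under conjugation and additive over the orbit.
  have hRtr : ∀ x, IsIdempotentElem x → LinearMap.trace K V x = (R x : K) :=
    fun x hx ↦ (LinearMap.IsIdempotentElem.isProj_range x hx).trace
  have hRsmul : ∀ (g : G) x, IsIdempotentElem x → R (g • x) = R x := by
    intro g x hx
    have h1 : IsIdempotentElem (g • x) := by
      change g • x * g • x = g • x
      rw [← smul_mul', hx.eq]
    have h2 := hRtr _ h1
    rw [smul_def, LinearMap.trace_mul_comm, ← mul_assoc, apply_inv_mul_apply, one_mul, hRtr x hx]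
      at h2
    exact_mod_cast h2.symm
  obtain ⟨u₀, hu₀, hmin⟩ : ∃ u, P u ∧ ∀ v, P v → R u ≤ R v := by
    have hex : ∃ n, ∃ u, P u ∧ R u = n :=
      ⟨_, 1, ⟨A.one_mem, fun x _ ↦ Commute.one_left x, IsIdempotentElem.one, one_ne_zero⟩, rfl⟩
    obtain ⟨u, hu, hun⟩ := Nat.find_spec hex
    exact ⟨u, hu, fun v hv ↦ hun ▸ Nat.find_min' hex ⟨v, hv, rfl⟩⟩
  -- two idempotents of minimal rank are orthogonal or equal
  have key : ∀ x y, P x → P y → R x = R u₀ → x * y ≠ 0 → x * y = x := by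
    rintro x y ⟨x1, x2, x3, x4⟩ ⟨y1, y2, y3, y4⟩ hRx hxy
    have hP : P (x * y) :=
      ⟨A.mul_mem x1 y1, fun z hz ↦ (x2 z hz).mul_left (y2 z hz),
        x3.mul_of_commute (x2 y y1) y3, hxy⟩
    have hle : LinearMap.range (x * y) ≤ LinearMap.range x := by
      rintro _ ⟨v, rfl⟩; exact ⟨y v, rfl⟩
    have heq : LinearMap.range (x * y) = LinearMap.range x :=
      Submodule.eq_of_le_of_finrank_le hle (hRx.le.trans (hmin _ hP))
    ext v
    have : x v ∈ LinearMap.range (x * y) := heq ▸ ⟨v, rfl⟩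
    obtain ⟨w, hw⟩ := this
    have h1 : (x * y) v = y (x v) := LinearMap.congr_fun (x2 y y1) v
    have h2 : (x * y) w = y (x w) := LinearMap.congr_fun (x2 y y1) w
    rw [h1, ← hw, h2]
    exact LinearMap.congr_fun y3 (x w)
  have horbP : ∀ x ∈ MulAction.orbit G u₀, P x ∧ R x = R u₀ := by
    rintro _ ⟨g, rfl⟩
    exact ⟨hPsmul g _ hu₀, hRsmul g _ hu₀.2.2.1⟩
  have hfin : (MulAction.orbit G u₀).Finite := Set.finite_range _
  let Ω : Finset (Module.End K V) := hfin.toFinset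
  have hΩ : ∀ x, x ∈ Ω ↔ x ∈ MulAction.orbit G u₀ := fun x ↦ hfin.mem_toFinset
  have horth : ∀ x ∈ Ω, ∀ y ∈ Ω, x ≠ y → x * y = 0 := by
    intro x hx y hy hne
    by_contra hxy
    obtain ⟨hPx, hRx⟩ := horbP x ((hΩ x).1 hx)
    obtain ⟨hPy, hRy⟩ := horbP y ((hΩ y).1 hy)
    have hc : x * y = y * x := hPx.2.1 y hPy.1
    exact hne ((key x y hPx hPy hRx hxy).symm.trans
      (hc.trans (key y x hPy hPx hRy (hc ▸ hxy))))
  have hΩmul : ∀ x ∈ Ω, (∑ y ∈ Ω, y) * x = x := by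
    intro x hx
    rw [Finset.sum_mul, Finset.sum_eq_single x]
    · exact (horbP x ((hΩ x).1 hx)).1.2.2.1
    · exact fun y hy hne ↦ horth y hy x hx hne
    · exact fun hx' ↦ absurd hx hx'
  have hs : ∑ y ∈ Ω, y = 1 := by
    have hcomm : ∀ g, Commute (∑ y ∈ Ω, y) (ρ g) := by
      intro g
      rw [← conj_eq_self_iff, ← smul_def, Finset.smul_sum]
      refine Finset.sum_nbij (g • ·) ?_ ?_ ?_ (fun _ _ ↦ rfl)
      · intro x hx
        rw [hΩ] at hx ⊢
        exact MulAction.mem_orbit_of_mem_orbit g hx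
      · exact fun x _ y _ hxy ↦ smul_left_cancel g hxy
      · intro x hx
        rw [Finset.mem_coe, hΩ] at hx
        refine ⟨g⁻¹ • x, ?_, smul_inv_smul g x⟩
        rw [Finset.mem_coe, hΩ]
        exact MulAction.mem_orbit_of_mem_orbit g⁻¹ hx
    have hid : IsIdempotentElem (∑ y ∈ Ω, y) := by
      change (∑ y ∈ Ω, y) * (∑ y ∈ Ω, y) = _
      rw [Finset.mul_sum]
      exact Finset.sum_congr rfl hΩmul
    have hmem : u₀ ∈ Ω := (hΩ _).2 (MulAction.mem_orbit_self u₀)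
    refine (h.eq_zero_or_eq_one hcomm hid).resolve_left fun h0 ↦ hu₀.2.2.2 ?_
    rw [← hΩmul u₀ hmem, h0, zero_mul]
  have hcount : Module.finrank K V = Ω.card * R u₀ := by
    have h1 := congrArg (LinearMap.trace K V) hs
    rw [map_sum, LinearMap.trace_one, Finset.sum_congr rfl (g := fun _ ↦ (R u₀ : K))] at h1
    · rw [Finset.sum_const, nsmul_eq_mul] at h1
      exact_mod_cast h1.symm
    · intro x hx
      obtain ⟨hPx, hRx⟩ := horbP x ((hΩ x).1 hx)
      rw [hRtr x hPx.2.2.1, hRx]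
  -- `N` fixes `u₀`, which is central in `A`, so the size of the orbit divides the index of `N`.
  have hcard : Ω.card ∣ ℓ ^ m := by
    have h1 : N ≤ MulAction.stabilizer G u₀ := by
      intro n hn
      rw [MulAction.mem_stabilizer_iff, smul_def, conj_eq_self_iff]
      exact hu₀.2.1 _ (hNA n hn)
    have h2 := Subgroup.index_dvd_of_le h1
    rwa [hind, MulAction.index_stabilizer, Set.ncard_eq_toFinset_card _ hfin] at h2
  have hone : Ω.card = 1 := by
    obtain ⟨b, -, hb⟩ := (Nat.dvd_prime_pow hℓ).1 hcard
    rcases b with _ | b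
    · simpa using hb
    · exact absurd (hcount ▸ hb ▸ (dvd_pow_self ℓ b.succ_ne_zero).mul_right _) hdim
  have hu₀1 : R u₀ = Module.finrank K V := by rw [hcount, hone, one_mul]
  by_cases hu0 : u = 0
  · exact Or.inl hu0
  · right
    have hP : P u := ⟨huA, hu, hi, hu0⟩
    have hr : LinearMap.range u = ⊤ :=
      Submodule.eq_top_of_finrank_eq (le_antisymm (Submodule.finrank_le _) (hu₀1 ▸ hmin u hP))
    ext v
    obtain ⟨w, rfl⟩ := LinearMap.range_eq_top.1 hr v
    exact LinearMap.congr_fun hi w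

end Representation

/-! ### The image of `K[N]` is a single matrix block. -/

namespace Representation

variable {K G V : Type*} [Field K] [Group G] [AddCommGroup V] [Module K V]

/-- The algebra of endomorphisms spanned by the image of the subgroup `N` is stable under
conjugation if `N` is normal. -/
theorem conj_mem_range_asAlgebraHom (ρ : Representation K G V) (N : Subgroup G) [N.Normal] (g : G)
    {x : Module.End K V} (hx : x ∈ (asAlgebraHom (ρ.comp N.subtype)).range) :
    ρ g * x * ρ g⁻¹ ∈ (asAlgebraHom (ρ.comp N.subtype)).range := by
  obtain ⟨y, rfl⟩ := hx
  induction y using MonoidAlgebra.induction_on with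
  | of n =>
    refine ⟨MonoidAlgebra.of K N ⟨g * n * g⁻¹, Subgroup.Normal.conj_mem inferInstance _ n.2 g⟩, ?_⟩
    simp
  | add a b ha hb =>
    have := add_mem ha hb
    simpa [mul_add, add_mul] using this
  | smul c a ha =>
    have := Subalgebra.smul_mem _ ha c
    simpa using this

variable {ρ : Representation K G V}

/-- Under the hypotheses on `N`, the algebra spanned by the image of `N` is a matrix algebra over
a field if the group algebra of `N` is quasisplit. -/
theorem IsIrreducible.exists_matrix_algHom [CharZero K] [FiniteDimensional K V]
    [Finite G] (h : ρ.IsIrreducible) (N : Subgroup G) [N.Normal] {ℓ m : ℕ} (hℓ : ℓ.Prime)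
    (hind : N.index = ℓ ^ m) (hdim : ¬ ℓ ∣ Module.finrank K V)
    {n : ℕ} {F : Fin n → Type*} {d : Fin n → ℕ} [∀ i, Field (F i)] [∀ i, Algebra K (F i)]
    [∀ i, NeZero (d i)]
    (Φ : MonoidAlgebra K N ≃ₐ[K] Π i, Matrix (Fin (d i)) (Fin (d i)) (F i)) :
    ∃ (i : Fin n) (Ψ : Matrix (Fin (d i)) (Fin (d i)) (F i) →ₐ[K] Module.End K V),
      Function.Injective Ψ ∧ Ψ.range = (asAlgebraHom (ρ.comp N.subtype)).range := by
  classical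
  obtain ⟨hnt, -⟩ := (isIrreducible_iff_forall_stable ρ).1 h
  set Θ := asAlgebraHom (ρ.comp N.subtype) with hΘ
  -- The units of the blocks map to central idempotents with sum `1`. Each is `0` or `1`, so some
  -- block has its unit acting as the identity, and that block carries the whole image.
  let ε : Fin n → Module.End K V := fun i ↦ Θ (Φ.symm (Pi.single i 1))
  have hcomm : ∀ i (z : Π i, Matrix (Fin (d i)) (Fin (d i)) (F i)),
      Pi.single i 1 * z = z * Pi.single i 1 := by
    intro i z
    ext j : 1
    by_cases hj : j = i
    · subst hj; simp
    · simp [hj]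
  have hε : ∀ i, ε i = 0 ∨ ε i = 1 := by
    intro i
    refine h.central_idempotent_eq_zero_or_one N hℓ hind hdim Θ.range
      (fun g x hx ↦ conj_mem_range_asAlgebraHom ρ N g hx)
      (fun k hk ↦ ⟨MonoidAlgebra.of K N ⟨k, hk⟩, by simp [hΘ]⟩) ⟨_, rfl⟩ ?_ ?_
    · rintro _ ⟨y, rfl⟩
      change Θ _ * Θ y = Θ y * Θ _
      rw [← map_mul, ← map_mul]
      congr 1
      apply Φ.injective
      rw [map_mul, map_mul, AlgEquiv.apply_symm_apply, hcomm]
    · change Θ _ * Θ _ = Θ _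
      rw [← map_mul, ← map_mul, ← Pi.single_mul, mul_one]
  have hsum : ∑ i, ε i = 1 := by
    change ∑ i, Θ (Φ.symm (Pi.single i 1)) = 1
    rw [← map_sum, ← map_sum, Finset.univ_sum_single (fun i ↦ (1 : Matrix _ _ (F i)))]
    exact (congrArg Θ (map_one Φ.symm)).trans (map_one Θ)
  obtain ⟨i, hi⟩ : ∃ i, ε i = 1 := by
    by_contra! hc
    refine one_ne_zero (α := Module.End K V) ?_
    rw [← hsum]
    exact Finset.sum_eq_zero fun i _ ↦ (hε i).resolve_right (hc i)
  let Ψ₀ : Matrix (Fin (d i)) (Fin (d i)) (F i) →ₗ[K] Module.End K V :=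
    Θ.toLinearMap ∘ₗ Φ.symm.toLinearMap ∘ₗ
      LinearMap.single K (fun i ↦ Matrix (Fin (d i)) (Fin (d i)) (F i)) i
  have hΨ₀ : ∀ x, Ψ₀ x = Θ (Φ.symm (Pi.single i x)) := fun _ ↦ rfl
  let Ψ : Matrix (Fin (d i)) (Fin (d i)) (F i) →ₐ[K] Module.End K V :=
    AlgHom.ofLinearMap Ψ₀ hi (fun x y ↦ by
      rw [hΨ₀, hΨ₀, hΨ₀, ← map_mul, ← map_mul, ← Pi.single_mul])
  have hΨ : ∀ x, Ψ x = Θ (Φ.symm (Pi.single i x)) := fun _ ↦ rfl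
  -- A nonzero matrix algebra over a field is a simple ring, whence the injectivity.
  refine ⟨i, Ψ, RingHom.injective Ψ.toRingHom, le_antisymm ?_ ?_⟩
  · rintro _ ⟨x, rfl⟩
    exact ⟨_, rfl⟩
  · rintro _ ⟨y, rfl⟩
    refine ⟨Φ y i, ?_⟩
    change Θ (Φ.symm (Pi.single i (Φ y i))) = Θ y
    have h1 : (Pi.single i (Φ y i) : Π i, Matrix (Fin (d i)) (Fin (d i)) (F i)) =
        Pi.single i 1 * Φ y := by
      ext j : 1
      by_cases hj : j = i
      · subst hj; simp
      · simp [hj]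
    rw [h1, map_mul, map_mul, AlgEquiv.symm_apply_apply]
    change ε i * Θ y = Θ y
    rw [hi, one_mul]

end Representation

/-! ### Skolem–Noether, and the dichotomy for the restriction to `N`. -/

/-- An algebra homomorphism factors through an injective one that has a larger range. -/
theorem AlgHom.exists_comp_eq_of_range_le {R A B C : Type*} [CommSemiring R] [Semiring A]
    [Semiring B] [Semiring C] [Algebra R A] [Algebra R B] [Algebra R C] {j : A →ₐ[R] B}
    (hj : Function.Injective j) (f : C →ₐ[R] B) (hf : ∀ x, f x ∈ j.range) :
    ∃ g : C →ₐ[R] A, ∀ x, j (g x) = f x :=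
  ⟨(AlgEquiv.ofInjective j hj).symm.toAlgHom.comp (f.codRestrict j.range hf), fun x ↦ by
    have := (AlgEquiv.ofInjective j hj).apply_symm_apply (f.codRestrict j.range hf x)
    exact congrArg Subtype.val this⟩

/-- The automorphisms of a matrix algebra over a field are inner. -/
theorem Matrix.exists_conj_of_algEquiv {n F : Type*} [Fintype n] [DecidableEq n] [Field F]
    (φ : Matrix n n F ≃ₐ[F] Matrix n n F) :
    ∃ a : (Matrix n n F)ˣ, ∀ x, φ x = a * x * (a⁻¹ : (Matrix n n F)ˣ) := by
  let e : Matrix n n F ≃ₐ[F] Module.End F (n → F) := Matrix.toLinAlgEquiv'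
  obtain ⟨T, hT⟩ := ((e.symm.trans φ).trans e).eq_linearEquivConjAlgEquiv
  let t : (Module.End F (n → F))ˣ := (LinearMap.GeneralLinearGroup.generalLinearEquiv F _).symm T
  refine ⟨Units.map e.symm.toMonoidHom t, fun x ↦ ?_⟩
  have h1 := DFunLike.congr_fun hT (e x)
  apply e.injective
  simp only [AlgEquiv.trans_apply, AlgEquiv.symm_apply_apply] at h1
  rw [h1, map_mul, map_mul]
  rw [← map_inv]
  change _ = e (e.symm t) * e x * e (e.symm _)
  rw [AlgEquiv.apply_symm_apply, AlgEquiv.apply_symm_apply]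
  rfl

/-- In a field, if a power of `f` coprime to `q` is a `q`-th power, then so is `f`. -/
theorem exists_pow_eq_of_coprime {F : Type*} [Field F] {f δ : F} (hf : f ≠ 0) {q k : ℕ}
    (hqk : Nat.Coprime k q) (h : δ ^ q = f ^ k) : ∃ μ : F, μ ^ q = f := by
  have hb : (k : ℤ) * k.gcdA q + q * k.gcdB q = 1 := by
    rw [← Nat.gcd_eq_gcd_ab, hqk, Nat.cast_one]
  refine ⟨δ ^ k.gcdA q * f ^ k.gcdB q, ?_⟩
  calc (δ ^ k.gcdA q * f ^ k.gcdB q) ^ q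
      = (δ ^ q) ^ k.gcdA q * f ^ (q * k.gcdB q) := by
        rw [mul_pow, ← zpow_natCast, ← zpow_mul, ← zpow_natCast, ← zpow_mul, mul_comm,
          mul_comm (k.gcdA q), zpow_mul δ, zpow_natCast, mul_comm (k.gcdB q)]
        ring
    _ = f ^ (k * k.gcdA q + q * k.gcdB q) := by
        rw [h, zpow_add₀ hf, zpow_mul f k, zpow_natCast]
    _ = f := by rw [hb, zpow_one]

/-- A field automorphism of finite `ℓ`-power order is trivial if the degree is prime to `ℓ`. -/
theorem AlgEquiv.eq_one_of_pow_eq_one_of_not_dvd {K F : Type*} [Field K] [Field F] [Algebra K F]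
    [FiniteDimensional K F] {ℓ m : ℕ} (hℓ : ℓ.Prime) (hdim : ¬ ℓ ∣ Module.finrank K F)
    (τ : F ≃ₐ[K] F) (hτ : τ ^ ℓ ^ m = 1) : τ = 1 := by
  obtain ⟨b, -, hb⟩ := (Nat.dvd_prime_pow hℓ).1 (orderOf_dvd_of_pow_eq_one hτ)
  rcases b with _ | b
  · rw [pow_zero] at hb
    exact orderOf_eq_one_iff.1 hb
  -- By Artin's theorem the order of `τ` is the degree of `F` over the fixed field of `τ`, a divisor
  -- of the degree over `K`.
  · have h1 := IntermediateField.finrank_fixedField_eq_card (Subgroup.zpowers τ)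
    rw [Nat.card_zpowers, hb] at h1
    have h2 := Module.finrank_mul_finrank K
      (IntermediateField.fixedField (Subgroup.zpowers τ)) F
    rw [h1] at h2
    exact absurd (h2 ▸ (dvd_pow_self ℓ b.succ_ne_zero).mul_left _) hdim

namespace Representation

variable {K G V : Type*} [Field K] [Group G] [AddCommGroup V] [Module K V]

/-- Conjugation by a group element as an algebra homomorphism. -/
def conjAlgHom (ρ : Representation K G V) (g : G) : Module.End K V →ₐ[K] Module.End K V :=
  let _ := ρ.conjAction
  AlgHom.ofLinearMap (LinearMap.mulRight K (ρ g⁻¹) ∘ₗ LinearMap.mulLeft K (ρ g)) (smul_one g)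
    (smul_mul' g)

theorem conjAlgHom_apply (ρ : Representation K G V) (g : G) (x : Module.End K V) :
    ρ.conjAlgHom g x = ρ g * x * ρ g⁻¹ := rfl

theorem conjAlgHom_injective (ρ : Representation K G V) (g : G) :
    Function.Injective (ρ.conjAlgHom g) := by
  let _ := ρ.conjAction
  exact MulAction.injective (β := Module.End K V) g

theorem conjAlgHom_mul_apply (ρ : Representation K G V) (g h : G) (x : Module.End K V) :
    ρ.conjAlgHom (g * h) x = ρ.conjAlgHom g (ρ.conjAlgHom h x) := by
  let _ := ρ.conjAction
  exact mul_smul g h x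

variable {ρ : Representation K G V}

/-- Let `N` be normal with cyclic quotient of `ℓ`-power order, generated by `γ`, and suppose that
the image of `N` spans a matrix algebra over a field. If the irreducible representation has
dimension prime to `ℓ`, then its restriction to `N` is irreducible or its endomorphism algebra
contains an element of order `ℓ`. -/
theorem IsIrreducible.restrict_or_exists_of_matrix [FiniteDimensional K V]
    (h : ρ.IsIrreducible) (N : Subgroup G) [N.Normal] {ℓ m : ℕ} (hℓ : ℓ.Prime)
    (hdim : ¬ ℓ ∣ Module.finrank K V) (γ : G) (hγ : γ ^ ℓ ^ m ∈ N)
    (hgen : ∀ g : G, ∃ k : ℕ, ∃ n ∈ N, g = γ ^ k * n)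
    {F : Type*} [Field F] [Algebra K F] {r : ℕ} [NeZero r]
    (Ψ : Matrix (Fin r) (Fin r) F →ₐ[K] Module.End K V) (hinj : Function.Injective Ψ)
    (hΨ : Ψ.range = (asAlgebraHom (ρ.comp N.subtype)).range) :
    IsIrreducible (ρ.comp N.subtype) ∨
      ∃ ζ : Module.End K V, (∀ g, Commute ζ (ρ g)) ∧ ζ ^ ℓ = 1 ∧ ζ ≠ 1 := by
  classical
  obtain ⟨hnt, hstab⟩ := (isIrreducible_iff_forall_stable ρ).1 h
  set q := ℓ ^ m with hq
  have hNΨ : ∀ n ∈ N, ∃ y, Ψ y = ρ n := by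
    intro n hn
    have : ρ n ∈ Ψ.range := by
      rw [hΨ]
      exact ⟨MonoidAlgebra.of K N ⟨n, hn⟩, by simp⟩
    exact this
  -- conjugation by `γ` on the matrix algebra
  obtain ⟨φ, hφ⟩ := AlgHom.exists_comp_eq_of_range_le hinj ((ρ.conjAlgHom γ).comp Ψ) (by
    intro x
    rw [hΨ]
    refine conj_mem_range_asAlgebraHom ρ N γ ?_
    rw [← hΨ]
    exact ⟨x, rfl⟩)
  replace hφ : ∀ x, Ψ (φ x) = ρ.conjAlgHom γ (Ψ x) := hφ
  have : FiniteDimensional K (Matrix (Fin r) (Fin r) F) :=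
    Module.Finite.of_injective Ψ.toLinearMap hinj
  have hφinj : Function.Injective φ := by
    intro x y hxy
    apply hinj
    apply ρ.conjAlgHom_injective γ
    rw [← hφ, ← hφ, hxy]
  have hφsurj : Function.Surjective φ := LinearMap.surjective_of_injective (f := φ.toLinearMap) hφinj
  let s : F →ₐ[K] Matrix (Fin r) (Fin r) F := IsScalarTower.toAlgHom K F _
  have hs : ∀ c, s c = algebraMap F _ c := fun _ ↦ rfl
  have hsinj : Function.Injective s := (algebraMap F (Matrix (Fin r) (Fin r) F)).injective
  have : FiniteDimensional K F := Module.Finite.of_injective s.toLinearMap hsinj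
  have hcenter : ∀ y : Matrix (Fin r) (Fin r) F, (∀ x, Commute x y) → ∃ c, y = s c := by
    intro y hy
    exact (Algebra.IsCentral.mem_center_iff F).1 (Subalgebra.mem_center_iff.2 fun x ↦ hy x)
  obtain ⟨τ, hτ⟩ := AlgHom.exists_comp_eq_of_range_le hsinj (φ.comp s) (by
    intro c
    obtain ⟨c', hc'⟩ := hcenter (φ (s c)) (fun x ↦ by
      obtain ⟨x, rfl⟩ := hφsurj x
      rw [commute_iff_eq, ← map_mul, ← map_mul, hs, Algebra.commutes])
    exact ⟨c', hc'.symm⟩)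
  replace hτ : ∀ c, s (τ c) = φ (s c) := hτ
  -- the vector space structure over the centre
  let _ : Module F V := Module.compHom V (Ψ.comp s).toRingHom
  have hsmul : ∀ (c : F) (v : V), c • v = Ψ (s c) v := fun _ _ ↦ rfl
  have : IsScalarTower K F V := ⟨fun k c v ↦ by
    rw [hsmul, hsmul, map_smul, map_smul, LinearMap.smul_apply]⟩
  have : FiniteDimensional F V := Module.Finite.of_restrictScalars_finite K F V
  have hKF := Module.finrank_mul_finrank K F V
  -- conjugation is linear over the centre
  have hτ1 : ∀ c, τ c = c := by
    let τ' : F ≃ₐ[K] F := AlgEquiv.ofBijective τ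
      ⟨τ.toRingHom.injective,
        LinearMap.surjective_of_injective (f := τ.toLinearMap) τ.toRingHom.injective⟩
    have hτ' : ∀ c, τ' c = τ c := fun _ ↦ rfl
    have hpow : ∀ (k : ℕ) c, Ψ (s ((τ' ^ k) c)) = ρ.conjAlgHom (γ ^ k) (Ψ (s c)) := by
      intro k
      induction k with
      | zero => intro c; simp [conjAlgHom_apply]
      | succ k ih =>
        intro c
        rw [pow_succ', AlgEquiv.mul_apply, hτ', hτ, hφ, ih, pow_succ', conjAlgHom_mul_apply]
    -- `γ ^ ℓ ^ m` lies in `N`, so conjugation by it fixes the centre `F` and `τ'` has `ℓ`-power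
    -- order; the degree of `F` divides `dim V`, so it is prime to `ℓ`.
    have h1 : τ' = 1 := by
      refine τ'.eq_one_of_pow_eq_one_of_not_dvd hℓ (fun hd ↦ hdim (hKF ▸ hd.mul_right _)) (m := m) ?_
      ext c
      apply hsinj
      apply hinj
      rw [hpow, conjAlgHom_apply, AlgEquiv.one_apply, conj_eq_self_iff]
      obtain ⟨y, hy⟩ := hNΨ _ hγ
      rw [← hy, commute_iff_eq, ← map_mul, ← map_mul, hs, Algebra.commutes]
    intro c
    rw [← hτ', h1, AlgEquiv.one_apply]
  let φ' : Matrix (Fin r) (Fin r) F ≃ₐ[F] Matrix (Fin r) (Fin r) F :=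
    AlgEquiv.ofRingEquiv (f := RingEquiv.ofBijective φ ⟨hφinj, hφsurj⟩) (fun c ↦ by
      change φ (s c) = s c
      rw [← hτ, hτ1])
  obtain ⟨a, ha⟩ := Matrix.exists_conj_of_algEquiv φ'
  replace ha : ∀ x, φ x = a * x * (a⁻¹ : (Matrix (Fin r) (Fin r) F)ˣ) := ha
  set a' : Matrix (Fin r) (Fin r) F := ↑(a⁻¹) with ha'
  have haa' : (a : Matrix (Fin r) (Fin r) F) * a' = 1 := a.mul_inv
  have ha'a : a' * (a : Matrix (Fin r) (Fin r) F) = 1 := a.inv_mul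
  -- `ρ γ` and `Ψ a` induce the same automorphism of the block, so their quotient `b` centralizes
  -- the block. It then commutes with `ρ γ = Ψ a * b` too, hence with all of `G`.
  let b : Module.End K V := Ψ a' * ρ γ
  have hab : Ψ a * b = ρ γ := by
    change Ψ a * (Ψ a' * ρ γ) = _
    rw [← mul_assoc, ← map_mul, haa', map_one, one_mul]
  have hbΨ : ∀ x, Commute b (Ψ x) := by
    intro x
    have h1 : ρ γ * Ψ x = Ψ (φ x) * ρ γ := by
      rw [hφ, conjAlgHom_apply, mul_assoc, apply_inv_mul_apply, mul_one]
    change Ψ a' * ρ γ * Ψ x = Ψ x * (Ψ a' * ρ γ)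
    rw [mul_assoc, h1, ha, ← mul_assoc, ← mul_assoc, ← map_mul, ← map_mul, ← mul_assoc, ← mul_assoc,
      ha'a, one_mul]
  have hGcomm : ∀ x : Module.End K V, (∀ y, Commute x (Ψ y)) → Commute x (ρ γ) →
      ∀ g, Commute x (ρ g) := by
    intro x hx hxγ g
    obtain ⟨k, n, hn, rfl⟩ := hgen g
    obtain ⟨y, hy⟩ := hNΨ n hn
    rw [map_mul, map_pow, ← hy]
    exact (hxγ.pow_right k).mul_right (hx y)
  have hbγ : Commute b (ρ γ) := hab ▸ (hbΨ a).mul_right (Commute.refl b)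
  have hbunit : IsUnit b := by
    refine (Units.isUnit (Units.map Ψ.toMonoidHom a⁻¹)).mul ?_
    exact ⟨⟨ρ γ, ρ γ⁻¹, apply_mul_apply_inv ρ γ, apply_inv_mul_apply ρ γ⟩, rfl⟩
  -- the `q`-th power of `b` lies in the centre
  obtain ⟨f, hf⟩ : ∃ f, b ^ q = Ψ (s f) := by
    obtain ⟨y, hy⟩ := hNΨ _ hγ
    have h1 : Ψ (a' ^ q * y) = b ^ q := by
      rw [map_mul, hy, map_pow ρ, ← hab, ((hbΨ a).symm).mul_pow, ← mul_assoc, map_pow, ← Commute.mul_pow,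
        ← map_mul, ha'a, map_one, one_pow, one_mul]
      rw [commute_iff_eq, ← map_mul, ← map_mul, haa', ha'a]
    obtain ⟨f, hf⟩ := hcenter (a' ^ q * y) (fun x ↦ by
      apply hinj
      rw [map_mul, map_mul _ _ x, h1]
      exact ((hbΨ x).pow_left q).symm)
    exact ⟨f, by rw [← h1, hf]⟩
  have hf0 : f ≠ 0 := by
    rintro rfl
    rw [map_zero, map_zero] at hf
    exact not_isUnit_zero (hf ▸ hbunit.pow q)
  -- Determinants over `F` turn `b ^ q = f` into `det b ^ q = f ^ dim_F V`. The exponent on the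
  -- right is prime to `ℓ`, so `f` itself is a `q`-th power and `b` can be normalized to satisfy `β
  -- ^ q = 1`.
  obtain ⟨μ, hμ⟩ : ∃ μ, μ ^ q = f := by
    let bF : V →ₗ[F] V :=
      { toFun := b
        map_add' := map_add b
        map_smul' := fun c v ↦ LinearMap.congr_fun (hbΨ (s c)) v }
    have hbF : bF ^ q = f • LinearMap.id := by
      ext v
      have h1 : ∀ k : ℕ, (bF ^ k) v = (b ^ k) v := by
        intro k
        induction k with
        | zero => rfl
        | succ k ih => rw [pow_succ', pow_succ', Module.End.mul_apply, Module.End.mul_apply, ih]; rfl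
      rw [h1, hf]
      rfl
    have h2 := congrArg LinearMap.det hbF
    rw [map_pow, LinearMap.det_smul, LinearMap.det_id, mul_one] at h2
    refine exists_pow_eq_of_coprime hf0 ?_ h2
    exact (Nat.Coprime.pow_left m ((Nat.Prime.coprime_iff_not_dvd hℓ).2
      fun hd ↦ hdim (hKF ▸ hd.mul_left _))).symm
  have hμ0 : μ ≠ 0 := by
    rintro rfl
    exact hf0 (by rw [← hμ, zero_pow (pow_ne_zero m hℓ.ne_zero)])
  let β : Module.End K V := Ψ (s μ⁻¹) * b
  have hμb : Ψ (s μ) * β = b := by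
    change Ψ (s μ) * (Ψ (s μ⁻¹) * b) = b
    rw [← mul_assoc, ← map_mul, ← map_mul, mul_inv_cancel₀ hμ0, map_one, map_one, one_mul]
  have hβq : β ^ q = 1 := by
    change (Ψ (s μ⁻¹) * b) ^ q = 1
    rw [((hbΨ (s μ⁻¹)).symm).mul_pow, hf, ← map_pow, ← map_pow, ← map_mul, ← map_mul, ← hμ, ← mul_pow,
      inv_mul_cancel₀ hμ0, one_pow, map_one, map_one]
  have hsΨ : ∀ c x, Commute (Ψ (s c)) (Ψ x) := by
    intro c x
    rw [commute_iff_eq, ← map_mul, ← map_mul, hs, Algebra.commutes]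
  have hβG : ∀ g, Commute β (ρ g) := by
    refine hGcomm β (fun y ↦ (hsΨ _ y).mul_left (hbΨ y)) (Commute.mul_left ?_ hbγ)
    rw [← hab]
    exact (hsΨ _ _).mul_right (hbΨ _).symm
  -- If `β = 1`, then `ρ γ` lies in the block, so an `N`-stable subspace is `G`-stable. Otherwise a
  -- suitable power of `β` has order exactly `ℓ`.
  by_cases hβ1 : β = 1
  · left
    rw [isIrreducible_iff_forall_stable]
    refine ⟨hnt, fun W hW ↦ hstab W ?_⟩
    have hWΨ : ∀ y, ∀ v ∈ W, Ψ y v ∈ W := by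
      intro y v hv
      have : Ψ y ∈ (asAlgebraHom (ρ.comp N.subtype)).range := hΨ ▸ ⟨y, rfl⟩
      obtain ⟨z, hz⟩ := this
      rw [← hz]
      change asAlgebraHom (ρ.comp N.subtype) z v ∈ W
      clear hz
      induction z using MonoidAlgebra.induction_on with
      | of n => simpa using hW n v hv
      | add a b ha hb => rw [map_add, LinearMap.add_apply]; exact add_mem ha hb
      | smul c a ha => rw [map_smul, LinearMap.smul_apply]; exact W.smul_mem c ha
    have hγΨ : ρ γ = Ψ (a * s μ) := by
      rw [← hab, ← hμb, hβ1, mul_one, ← map_mul]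
    intro g v hv
    obtain ⟨k, n, hn, rfl⟩ := hgen g
    obtain ⟨y, hy⟩ := hNΨ n hn
    rw [map_mul, map_pow, hγΨ, ← hy, ← map_pow, ← map_mul]
    exact hWΨ _ v hv
  · right
    have hfin : 0 < orderOf β := orderOf_pos_iff.2
      (isOfFinOrder_iff_pow_eq_one.2 ⟨q, Nat.pos_of_ne_zero (pow_ne_zero m hℓ.ne_zero), hβq⟩)
    have hdvd : ℓ ∣ orderOf β := by
      obtain ⟨j, -, hj⟩ := (Nat.dvd_prime_pow hℓ).1 (orderOf_dvd_of_pow_eq_one hβq)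
      rcases j with _ | j
      · rw [pow_zero] at hj
        exact absurd (orderOf_eq_one_iff.1 hj) hβ1
      · exact hj ▸ dvd_pow_self ℓ j.succ_ne_zero
    have hord := orderOf_pow_orderOf_div hfin.ne' hdvd
    refine ⟨β ^ (orderOf β / ℓ), fun g ↦ (hβG g).pow_left _, ?_, fun h1 ↦ ?_⟩
    · have := pow_orderOf_eq_one (β ^ (orderOf β / ℓ))
      rwa [hord] at this
    · rw [h1, orderOf_one] at hord
      exact hℓ.one_lt.ne hord

/-- Let `G` satisfy `(D_ℓ)` by way of `N` with `K[N]` quasisplit. An irreducible representation of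
dimension prime to `ℓ` remains irreducible on `N`, or its endomorphism algebra contains an element
of order `ℓ`. -/
theorem IsIrreducible.restrict_or_exists [CharZero K] [FiniteDimensional K V]
    (h : ρ.IsIrreducible) (N : Subgroup G) [N.Normal] {ℓ : ℕ} (hG : SatisfiesDVia ℓ G N)
    (hN : IsQuasisplit K (MonoidAlgebra K N)) (hdim : ¬ ℓ ∣ Module.finrank K V) :
    IsIrreducible (ρ.comp N.subtype) ∨
      ∃ ζ : Module.End K V, (∀ g, Commute ζ (ρ g)) ∧ ζ ^ ℓ = 1 ∧ ζ ≠ 1 := by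
  have := hG.finite
  have : Fact ℓ.Prime := ⟨hG.prime⟩
  obtain ⟨m, hm⟩ := IsPGroup.iff_card.1 hG.isPGroup
  obtain ⟨-, n, F, d, _, _, _, ⟨Φ⟩⟩ := hN
  obtain ⟨i, Ψ, hinj, hΨ⟩ := h.exists_matrix_algHom N hG.prime hm hdim Φ
  obtain ⟨γ', hγ'⟩ := hG.isCyclic.exists_generator
  obtain ⟨γ, rfl⟩ := QuotientGroup.mk_surjective γ'
  refine h.restrict_or_exists_of_matrix N hG.prime hdim γ (m := m) ?_ (fun g ↦ ?_) Ψ hinj hΨ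
  · rw [← QuotientGroup.eq_one_iff, QuotientGroup.mk_pow, ← hm, pow_card_eq_one']
  · obtain ⟨k, hk⟩ := mem_powers_iff_mem_zpowers.2 (hγ' g)
    refine ⟨k, (γ ^ k)⁻¹ * g, ?_, by rw [mul_inv_cancel_left]⟩
    exact QuotientGroup.eq.1 hk

end Representation

/-! ### Chains of lattices `u ^ i T` over a discrete valuation ring. -/

namespace Submodule

section Units

variable {O K V : Type*} [CommRing O] [Field K] [Algebra O K] [AddCommGroup V] [Module K V]
  [Module O V] [IsScalarTower O K V]

theorem mem_units_smul_iff (u : (Module.End K V)ˣ) (T : Submodule O V) (x : V) :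
    x ∈ u • T ↔ u⁻¹ • x ∈ T := by
  constructor
  · rintro ⟨y, hy, rfl⟩
    change u⁻¹ • u • y ∈ T
    rwa [inv_smul_smul]
  · intro h
    exact ⟨_, h, smul_inv_smul u x⟩

theorem units_smul_le_iff (u : (Module.End K V)ˣ) (S T : Submodule O V) :
    u • S ≤ T ↔ S ≤ u⁻¹ • T := by
  constructor
  · intro h x hx
    rw [mem_units_smul_iff, inv_inv]
    exact h ⟨x, hx, rfl⟩
  · rintro h _ ⟨x, hx, rfl⟩
    have := h hx
    rwa [mem_units_smul_iff, inv_inv] at this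

theorem units_smul_mono (u : (Module.End K V)ˣ) {S T : Submodule O V} (h : S ≤ T) :
    u • S ≤ u • T := by
  rw [units_smul_le_iff, inv_smul_smul]; exact h

theorem units_pow_smul_le {u : (Module.End K V)ˣ} {T : Submodule O V} (h : u • T ≤ T) (n : ℕ) :
    u ^ n • T ≤ T := by
  induction n with
  | zero => rw [pow_zero, one_smul]
  | succ n ih =>
    rw [pow_succ, mul_smul]
    exact (units_smul_mono _ h).trans ih

theorem units_zpow_smul_le_of_le {u : (Module.End K V)ˣ} {T : Submodule O V} (h : u • T ≤ T)
    {i j : ℤ} (hij : i ≤ j) : u ^ j • T ≤ u ^ i • T := by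
  obtain ⟨n, rfl⟩ := Int.le.dest hij
  rw [zpow_add, mul_smul, zpow_natCast]
  exact units_smul_mono _ (units_pow_smul_le h n)

instance isLattice_units_smul (u : (Module.End K V)ˣ) (T : Submodule O V) [hT : IsLattice K T] :
    IsLattice K (u • T) where
  fg := hT.fg.map _
  span_eq_top := by
    have h1 : ((u • T : Submodule O V) : Set V) = (u : Module.End K V) '' (T : Set V) := rfl
    rw [h1, ← Submodule.map_span, hT.span_eq_top, Submodule.map_top, LinearMap.range_eq_top]
    exact ((Module.End.isUnit_iff _).1 u.isUnit).2

end Units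

section DiscreteValuationRing

variable {O K V : Type*} [CommRing O] [IsDomain O] [IsDiscreteValuationRing O] [Field K]
  [Algebra O K] [AddCommGroup V] [Module K V] [Module O V] [IsScalarTower O K V]

/-- Nakayama's lemma for a discrete valuation ring. -/
theorem le_of_forall_exists_add_smul {ϖ : O} (hϖ : Irreducible ϖ) {S T : Submodule O V}
    (hT : T.FG) (h : ∀ x ∈ T, ∃ y ∈ S, ∃ z ∈ T, x = y + ϖ • z) : T ≤ S := by
  refine le_of_le_smul_of_le_jacobson_bot (I := IsLocalRing.maximalIdeal O) hT
    (IsLocalRing.maximalIdeal_le_jacobson ⊥) fun x hx ↦ ?_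
  obtain ⟨y, hy, z, hz, rfl⟩ := h x hx
  refine add_mem (mem_sup_left hy) (mem_sup_right (smul_mem_smul ?_ hz))
  rw [IsLocalRing.mem_maximalIdeal]
  exact hϖ.not_isUnit

/-- If `T / u T` has no proper stable submodules and `u` is topologically nilpotent on `T`, then
a stable submodule of `T` which is not contained in `u T` is `T`. -/
theorem eq_of_stable_of_not_le {ϖ : O} (hϖ : Irreducible ϖ) (𝒮 : Set (Module.End K V))
    {u : (Module.End K V)ˣ} (h𝒮u : ∀ s ∈ 𝒮, Commute s (u : Module.End K V))
    {T : Submodule O V} (hT : T.FG) (h𝒮T : ∀ s ∈ 𝒮, ∀ x ∈ T, s x ∈ T)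
    {M : ℕ} (hM : ∀ x ∈ T, ∃ y ∈ T, u ^ M • x = ϖ • y)
    (hmax : ∀ S : Submodule O V, (∀ s ∈ 𝒮, ∀ x ∈ S, s x ∈ S) → u • T ≤ S → S ≤ T →
      S = u • T ∨ S = T)
    (huT : u • T ≤ T) {T' : Submodule O V} (hle : T' ≤ T) (h𝒮T' : ∀ s ∈ 𝒮, ∀ x ∈ T', s x ∈ T')
    (huT' : u • T' ≤ T') (hnle : ¬ T' ≤ u • T) : T' = T := by
  -- By simplicity `T'` surjects onto `T / u T`. Iterating gives `T = T' + u ^ k T` for all `k`, and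
  -- at `k = M` Nakayama applies because `u ^ M T ⊆ ϖ T`.
  have hsup : T' ⊔ u • T = T := by
    refine (hmax _ ?_ le_sup_right (sup_le hle huT)).resolve_left fun h ↦ hnle (h ▸ le_sup_left)
    intro s hs x hx
    obtain ⟨a, ha, _, ⟨b, hb, rfl⟩, rfl⟩ := mem_sup.1 hx
    rw [map_add]
    refine add_mem (mem_sup_left (h𝒮T' s hs a ha)) (mem_sup_right ⟨s b, h𝒮T s hs b hb, ?_⟩)
    exact (LinearMap.congr_fun (h𝒮u s hs) b).symm
  have hpow : ∀ k : ℕ, T ≤ T' ⊔ u ^ k • T := by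
    intro k
    induction k with
    | zero => rw [pow_zero, one_smul]; exact le_sup_right
    | succ k ih =>
      have h1 : u • T ≤ T' ⊔ u ^ (k + 1) • T := by
        refine (units_smul_mono u ih).trans ?_
        rintro _ ⟨x, hx, rfl⟩
        obtain ⟨a, ha, b, hb, rfl⟩ := mem_sup.1 hx
        refine (map_add (u : Module.End K V) a b).symm ▸
          add_mem (mem_sup_left (huT' ⟨a, ha, rfl⟩)) (mem_sup_right ?_)
        rw [pow_succ', mul_smul]
        exact ⟨b, hb, rfl⟩
      calc T = T' ⊔ u • T := hsup.symm
        _ ≤ _ := sup_le le_sup_left h1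
  refine le_antisymm hle (le_of_forall_exists_add_smul hϖ hT fun x hx ↦ ?_)
  obtain ⟨a, ha, _, ⟨b, hb, rfl⟩, rfl⟩ := mem_sup.1 (hpow M hx)
  obtain ⟨y, hy, hyb⟩ := hM b hb
  exact ⟨a, ha, y, hy, by rw [← hyb]; rfl⟩

variable [IsFractionRing O K]

/-- Each element of the fraction field becomes integral after multiplication by a power of the
uniformizer. -/
theorem exists_pow_smul_mem_range {ϖ : O} (hϖ : Irreducible ϖ) (c : K) :
    ∃ (k : ℕ) (a : O), ϖ ^ k • c = algebraMap O K a := by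
  obtain ⟨p, q, hq, rfl⟩ := IsFractionRing.div_surjective (A := O) c
  have hq0 : q ≠ 0 := nonZeroDivisors.ne_zero hq
  obtain ⟨k, hk⟩ := IsDiscreteValuationRing.associated_pow_irreducible hq0 hϖ
  obtain ⟨v, hv⟩ := hk
  have hq' : algebraMap O K q ≠ 0 := by
    rwa [Ne, IsFractionRing.to_map_eq_zero_iff]
  refine ⟨k, v * p, ?_⟩
  rw [← hv, Algebra.smul_def, map_mul, map_mul]
  field_simp

theorem exists_pow_smul_mem {ϖ : O} (hϖ : Irreducible ϖ) (T : Submodule O V) [hT : IsLattice K T]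
    (x : V) : ∃ k : ℕ, ϖ ^ k • x ∈ T := by
  have hx : x ∈ span K (T : Set V) := hT.span_eq_top ▸ mem_top
  induction hx using span_induction with
  | mem x hx => exact ⟨0, by simpa using hx⟩
  | zero => exact ⟨0, by simp⟩
  | add x y _ _ hx hy =>
    obtain ⟨k, hk⟩ := hx
    obtain ⟨l, hl⟩ := hy
    refine ⟨k + l, ?_⟩
    rw [smul_add]
    refine add_mem ?_ ?_
    · rw [pow_add, mul_comm, mul_smul]; exact T.smul_mem _ hk
    · rw [pow_add, mul_smul]; exact T.smul_mem _ hl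
  | smul c x _ hx =>
    obtain ⟨k, hk⟩ := hx
    obtain ⟨l, a, hl⟩ := exists_pow_smul_mem_range hϖ c
    refine ⟨l + k, ?_⟩
    have : ϖ ^ (l + k) • c • x = a • ϖ ^ k • x := by
      rw [pow_add, mul_comm, mul_smul, ← smul_assoc (ϖ ^ l) c x, hl, algebraMap_smul, smul_comm]
    rw [this]
    exact T.smul_mem _ hk

/-- Two lattices are commensurable. -/
theorem exists_pow_smul_le {ϖ : O} (hϖ : Irreducible ϖ) {S : Submodule O V} (hS : S.FG)
    (T : Submodule O V) [IsLattice K T] : ∃ k : ℕ, ∀ x ∈ S, ϖ ^ k • x ∈ T := by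
  obtain ⟨s, rfl⟩ := hS
  choose k hk using fun x ↦ exists_pow_smul_mem (K := K) hϖ T x
  refine ⟨s.sup k, fun x hx ↦ ?_⟩
  induction hx using span_induction with
  | mem x hx =>
    obtain ⟨j, hj⟩ := Nat.exists_eq_add_of_le (Finset.le_sup (f := k) hx)
    rw [hj, pow_add, mul_comm, mul_smul]
    exact T.smul_mem _ (hk x)
  | zero => simp
  | add x y _ _ hx hy => rw [smul_add]; exact add_mem hx hy
  | smul a x _ hx => rw [smul_comm]; exact T.smul_mem _ hx

/-- If `T / u T` has no proper stable submodules and `u` is topologically nilpotent on the lattice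
`T`, then the stable lattices form the chain of the `u ^ i T`. -/
theorem exists_eq_zpow_smul [Nontrivial V] {ϖ : O} (hϖ : Irreducible ϖ)
    (𝒮 : Set (Module.End K V))
    {u : (Module.End K V)ˣ} (h𝒮u : ∀ s ∈ 𝒮, Commute s (u : Module.End K V))
    {T : Submodule O V} [hT : IsLattice K T] (h𝒮T : ∀ s ∈ 𝒮, ∀ x ∈ T, s x ∈ T)
    {M : ℕ} (hM : ∀ x ∈ T, ∃ y ∈ T, u ^ M • x = ϖ • y)
    (hmax : ∀ S : Submodule O V, (∀ s ∈ 𝒮, ∀ x ∈ S, s x ∈ S) → u • T ≤ S → S ≤ T →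
      S = u • T ∨ S = T)
    (huT : u • T ≤ T) {T' : Submodule O V} [hT' : IsLattice K T']
    (h𝒮T' : ∀ s ∈ 𝒮, ∀ x ∈ T', s x ∈ T')
    (huT' : u • T' ≤ T') : ∃ i : ℤ, T' = u ^ i • T := by
  have hpow : ∀ n : ℕ, ∀ x ∈ T, ∃ y ∈ T, u ^ (M * n) • x = ϖ ^ n • y := by
    intro n
    induction n with
    | zero => intro x hx; exact ⟨x, hx, by simp⟩
    | succ n ih =>
      intro x hx
      obtain ⟨y, hy, hxy⟩ := hM x hx
      obtain ⟨z, hz, hyz⟩ := ih y hy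
      refine ⟨z, hz, ?_⟩
      rw [mul_add, mul_one, pow_add, mul_smul, hxy, smul_comm, hyz, pow_succ', mul_smul]
  -- Some `u ^ i T` contains `T'` because the lattices are commensurable. The exponents are bounded,
  -- since otherwise `ϖ ^ n T ⊆ T' ⊆ ϖ ^ (n + 1) T` for some `n`, and `T = 0` by Nakayama. For the
  -- greatest `i` the lattice `u ^ (-i) T'` lies in `T` but not in `u T`.
  have hne : ∃ i : ℤ, T' ≤ u ^ i • T := by
    obtain ⟨n, hn⟩ := exists_pow_smul_le (K := K) hϖ hT'.fg T
    refine ⟨-((M * n : ℕ) : ℤ), fun x hx ↦ ?_⟩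
    rw [mem_units_smul_iff, ← zpow_neg, neg_neg, zpow_natCast]
    have h0 : (algebraMap O K (ϖ ^ n)) ≠ 0 := by
      rw [Ne, IsFractionRing.to_map_eq_zero_iff]; exact pow_ne_zero n hϖ.ne_zero
    obtain ⟨y, hy, hxy⟩ := hpow n _ (hn x hx)
    rw [smul_comm, ← algebraMap_smul K, ← algebraMap_smul K (ϖ ^ n) y] at hxy
    rwa [smul_right_injective V h0 hxy]
  have hbdd : ∃ b : ℤ, ∀ i : ℤ, T' ≤ u ^ i • T → i ≤ b := by
    obtain ⟨n, hn⟩ := exists_pow_smul_le (K := K) hϖ hT.fg T'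
    refine ⟨(M * (n + 1) : ℕ), fun i hi ↦ ?_⟩
    by_contra! hlt
    have h1 : T' ≤ u ^ (M * (n + 1)) • T := by
      refine hi.trans ?_
      rw [← zpow_natCast]
      exact units_zpow_smul_le_of_le huT hlt.le
    have h2 : T ≤ ⊥ := by
      refine le_of_forall_exists_add_smul hϖ hT.fg fun x hx ↦ ?_
      obtain ⟨z, hz, hzx⟩ := h1 (hn x hx)
      obtain ⟨y, hy, hzy⟩ := hpow (n + 1) z hz
      refine ⟨0, zero_mem _, y, hy, ?_⟩
      have h0 : (algebraMap O K (ϖ ^ n)) ≠ 0 := by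
        rw [Ne, IsFractionRing.to_map_eq_zero_iff]; exact pow_ne_zero n hϖ.ne_zero
      have h3 : ϖ ^ n • x = ϖ ^ n • ϖ • y := by
        rw [← hzx, ← mul_smul, ← pow_succ, ← hzy]; rfl
      rw [← algebraMap_smul K, ← algebraMap_smul K (ϖ ^ n) (ϖ • y)] at h3
      rw [zero_add, smul_right_injective V h0 h3]
    have h3 := hT.span_eq_top
    rw [le_bot_iff.1 h2, bot_coe, span_zero_singleton] at h3
    exact bot_ne_top h3
  obtain ⟨i, hi, himax⟩ := Int.exists_greatest_of_bdd hbdd hne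
  refine ⟨i, ?_⟩
  have hcu : ∀ s ∈ 𝒮, ∀ (j : ℤ) (x : V), s (u ^ j • x) = u ^ j • s x := by
    intro s hs j x
    exact LinearMap.congr_fun ((h𝒮u s hs).units_zpow_right j) x
  have key : u ^ (-i) • T' = T := by
    refine eq_of_stable_of_not_le hϖ 𝒮 h𝒮u hT.fg h𝒮T hM hmax huT ?_ ?_ ?_ ?_
    · rwa [units_smul_le_iff, zpow_neg, inv_inv]
    · rintro s hs _ ⟨x, hx, rfl⟩
      exact ⟨s x, h𝒮T' s hs x hx, (hcu s hs _ x).symm⟩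
    · rw [← mul_smul, ← zpow_one_add, add_comm, zpow_add_one, mul_smul]
      exact units_smul_mono _ huT'
    · intro hle
      rw [units_smul_le_iff, ← mul_smul, zpow_neg, inv_inv, ← zpow_add_one] at hle
      have := himax _ hle
      lia
  rw [← key, ← mul_smul, ← zpow_add, add_neg_cancel, zpow_zero, one_smul]

end DiscreteValuationRing

end Submodule

/-! ### Stable lattices, dual lattices and perfect forms. -/

namespace Submodule

variable {O K V : Type*} [CommRing O] [Field K] [Algebra O K] [AddCommGroup V] [Module K V]
  [Module O V] [IsScalarTower O K V]

variable (O) in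
/-- A finite monoid acting linearly stabilizes a lattice. -/
theorem exists_isLattice_stable [FiniteDimensional K V] {M : Type*} [Monoid M] [Finite M]
    (φ : M →* Module.End K V) :
    ∃ T : Submodule O V, IsLattice K T ∧ ∀ g, ∀ x ∈ T, φ g x ∈ T := by
  let b := Module.finBasis K V
  -- All translates of a basis. Inverses are not needed, so this also serves the monoid of powers of
  -- one endomorphism.
  let s : Set V := Set.range fun p : M × Fin (Module.finrank K V) ↦ φ p.1 (b p.2)
  refine ⟨span O s, ⟨fg_span (Set.finite_range _), ?_⟩, fun g x hx ↦ ?_⟩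
  · rw [span_span_of_tower, eq_top_iff, ← b.span_eq]
    refine span_mono ?_
    rintro _ ⟨i, rfl⟩
    exact ⟨(1, i), by simp⟩
  · induction hx using span_induction with
    | mem x hx =>
      obtain ⟨⟨h, i⟩, rfl⟩ := hx
      exact subset_span ⟨(g * h, i), by simp⟩
    | zero => simp
    | add x y _ _ hx hy => rw [map_add]; exact add_mem hx hy
    | smul a x _ hx =>
      rw [← algebraMap_smul K, map_smul, algebraMap_smul]
      exact Submodule.smul_mem _ _ hx

variable [IsDomain O] [IsDiscreteValuationRing O] [IsFractionRing O K]

/-- The dual of a lattice for a nondegenerate form is a lattice. -/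
theorem isLattice_dualSubmodule [FiniteDimensional K V] {f : LinearMap.BilinForm K V}
    (hf : f.Nondegenerate) (T : Submodule O V) [hT : IsLattice K T] :
    IsLattice K (f.dualSubmodule T) := by
  classical
  have : Module.IsTorsionFree O K := inferInstance
  have := IsLattice.free K T
  let b := Module.Free.chooseBasis O T
  let bK := b.extendOfIsLattice K
  have h1 : T = span O (Set.range bK) := by
    have h2 : Set.range bK = T.subtype '' Set.range b := by
      rw [← Set.range_comp]
      congr 1
      ext i
      exact b.extendOfIsLattice_apply K i
    rw [h2, ← map_span, b.span_eq, map_top, range_subtype]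
  have h3 : f.dualSubmodule T = span O (Set.range (f.dualBasis hf bK)) := by
    conv_lhs => rw [h1]
    exact f.dualSubmodule_span_of_basis hf bK
  rw [h3]
  refine ⟨fg_span (Set.finite_range _), ?_⟩
  rw [span_span_of_tower, Module.Basis.span_eq]

/-- A stable lattice which is its own dual for an invariant alternating form carries a perfect
invariant alternating form. -/
theorem exists_perfect_of_dualSubmodule_eq [FiniteDimensional K V] {G : Type*} [Group G]
    {ρ : Representation K G V} {f : LinearMap.BilinForm K V} (hf : f.Nondegenerate)
    (halt : f.IsAlt) (hinv : ∀ (g : G) (x y : V), f (ρ g x) (ρ g y) = f x y)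
    (T : Submodule O V) [hT : IsLattice K T] (hG : ∀ g, ∀ x ∈ T, ρ g x ∈ T)
    (hdual : f.dualSubmodule T = T) :
    ∃ (T : Submodule O V) (_ : IsLattice K T) (hT : ∀ (g : G), ∀ x ∈ T, ρ g x ∈ T)
      (f' : LinearMap.BilinForm O T), f'.IsPerfPair ∧ f'.IsAlt ∧
        ∀ (g : G) (x y : T), f' ⟨ρ g x, hT g x x.2⟩ ⟨ρ g y, hT g y y.2⟩ = f' x y := by
  classical
  have := IsLattice.free K T
  have hOK : Function.Injective (algebraMap O K) := IsFractionRing.injective O K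
  let f' : LinearMap.BilinForm O T :=
    f.dualSubmoduleToDual T ∘ₗ (LinearEquiv.ofEq _ _ hdual.symm).toLinearMap
  have hf' : ∀ x y : T, algebraMap O K (f' x y) = f x y := fun x y ↦
    f.dualSubmoduleParing_spec (LinearEquiv.ofEq _ _ hdual.symm x) y
  have hf'alt : f'.IsAlt := fun x ↦ hOK (by rw [hf', map_zero]; exact halt x)
  have hinj : Function.Injective f' :=
    (f.dualSubmoduleToDual_injective hf T hT.span_eq_top).comp (LinearEquiv.injective _)
  have hsurj : Function.Surjective f' := by
    intro φ
    let b := Module.Free.chooseBasis O T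
    let bK := b.extendOfIsLattice K
    let φK : V →ₗ[K] K := bK.constr K fun i ↦ algebraMap O K (φ (b i))
    have hφK : ∀ y : T, φK y = algebraMap O K (φ y) := by
      have : φK.restrictScalars O ∘ₗ T.subtype = (Algebra.linearMap O K) ∘ₗ φ := by
        refine b.ext fun i ↦ ?_
        have h1 : φK (bK i) = algebraMap O K (φ (b i)) := bK.constr_basis K _ i
        rw [b.extendOfIsLattice_apply K] at h1
        exact h1
      exact fun y ↦ LinearMap.congr_fun this y
    -- The functional extends to `V` and is represented by a vector there; its integrality on `T`
    -- puts that vector in the dual lattice, which is `T`.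
    obtain ⟨v, hv⟩ := (f.toDual hf).surjective φK
    have hv' : ∀ y, f v y = φK y := fun y ↦ by rw [← hv]; rfl
    have hvT : v ∈ T := by
      rw [← hdual, LinearMap.BilinForm.mem_dualSubmodule]
      intro y hy
      rw [hv', hφK ⟨y, hy⟩]
      exact mem_one.2 ⟨_, rfl⟩
    refine ⟨⟨v, hvT⟩, LinearMap.ext fun y ↦ hOK ?_⟩
    rw [hf', hv', hφK]
  refine ⟨T, hT, hG, f', ⟨⟨hinj, hsurj⟩, ?_⟩, hf'alt, fun g x y ↦ hOK ?_⟩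
  · have h1 : LinearMap.flip f' = -f' := by
      ext x y
      exact (hf'alt.neg_eq x y).symm
    rw [h1]
    exact (neg_involutive.bijective).comp ⟨hinj, hsurj⟩
  · rw [hf', hf']
    exact hinv g x y

end Submodule

/-! ### Completeness and the lifting of idempotents. -/

/-- A finite free module over a complete ring is complete. -/
theorem Module.Free.exists_limit {O E : Type*} [CommRing O] [AddCommGroup E] [Module O E]
    [Module.Free O E] [Module.Finite O E] {ϖ : O}
    (hc : ∀ a : ℕ → O, (∀ n, ϖ ^ n ∣ a (n + 1) - a n) → ∃ L, ∀ n, ϖ ^ n ∣ L - a n)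
    (a : ℕ → E) (ha : ∀ n, ∃ r : E, a (n + 1) - a n = ϖ ^ n • r) :
    ∃ L : E, ∀ n, ∃ r : E, L - a n = ϖ ^ n • r := by
  let b := Module.Free.chooseBasis O E
  have hlim : ∀ i, ∃ L, ∀ n, ϖ ^ n ∣ L - b.repr (a n) i := by
    intro i
    refine hc (fun n ↦ b.repr (a n) i) fun n ↦ ?_
    obtain ⟨r, hr⟩ := ha n
    refine ⟨b.repr r i, ?_⟩
    rw [← smul_eq_mul, ← Finsupp.smul_apply, ← map_smul, ← hr, map_sub, Finsupp.sub_apply]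
  choose L hL using hlim
  choose r hr using hL
  refine ⟨∑ i, L i • b i, fun n ↦ ⟨∑ i, r i n • b i, ?_⟩⟩
  conv_lhs => rw [← b.sum_repr (a n)]
  rw [← Finset.sum_sub_distrib, Finset.smul_sum]
  refine Finset.sum_congr rfl fun i _ ↦ ?_
  rw [← sub_smul, hr, mul_smul]

namespace IsDiscreteValuationRing

variable {O : Type*} [CommRing O] [IsDomain O] [IsDiscreteValuationRing O] {ϖ : O}

theorem eq_zero_of_forall_pow_dvd (hϖ : Irreducible ϖ) {x : O} (hx : ∀ n : ℕ, ϖ ^ n ∣ x) :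
    x = 0 := by
  by_contra h0
  obtain ⟨k, hk⟩ := associated_pow_irreducible h0 hϖ
  have h1 := (hx (k + 1)).trans hk.dvd
  have := (pow_dvd_pow_iff hϖ.ne_zero hϖ.not_isUnit).1 h1
  lia

variable {E : Type*} [AddCommGroup E] [Module O E] [Module.Free O E]

theorem eq_zero_of_forall_exists_eq_pow_smul (hϖ : Irreducible ϖ) {x : E}
    (hx : ∀ n : ℕ, ∃ r : E, x = ϖ ^ n • r) : x = 0 := by
  let b := Module.Free.chooseBasis O E
  refine b.ext_elem fun i ↦ ?_
  rw [map_zero, Finsupp.zero_apply]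
  refine eq_zero_of_forall_pow_dvd hϖ fun n ↦ ?_
  obtain ⟨r, hr⟩ := hx n
  exact ⟨b.repr r i, by rw [hr]; simp⟩

variable {R : Type*} [Ring R] [Algebra O R] [Module.Free O R] [Module.Finite O R]

/-- Idempotents can be lifted in a finite free algebra over a complete discrete valuation ring. -/
theorem exists_isIdempotentElem (hϖ : Irreducible ϖ)
    (hc : ∀ a : ℕ → O, (∀ n, ϖ ^ n ∣ a (n + 1) - a n) → ∃ L, ∀ n, ϖ ^ n ∣ L - a n)
    {p r : R} (hp : p * p - p = ϖ • r) :
    ∃ P : R, IsIdempotentElem P ∧ (∃ s, P - p = ϖ • s) ∧ ∀ x, Commute x p → Commute x P := by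
  -- Newton's iteration for `p ^ 2 = p`: the defect of `t p` is a multiple of the square of the
  -- defect of `p`. One more factor `ϖ` per step suffices for convergence.
  let t : R → R := fun p ↦ 3 * (p * p) - 2 * (p * p * p)
  let a : ℕ → R := fun n ↦ t^[n] p
  have ha0 : a 0 = p := rfl
  have has : ∀ n, a (n + 1) = t (a n) := fun n ↦ Function.iterate_succ_apply' t n p
  have hstep : ∀ n, ∃ r, a n * a n - a n = ϖ ^ (n + 1) • r := by
    intro n
    induction n with
    | zero => exact ⟨r, by simpa [ha0] using hp⟩
    | succ n ih =>
      obtain ⟨r, hr⟩ := ih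
      have h1 : t (a n) * t (a n) - t (a n) =
          (a n * a n - a n) * (a n * a n - a n) * (4 * (a n * a n - a n) - 3) := by
        simp only [t]
        noncomm_ring
      refine ⟨ϖ ^ n • (r * r * (4 * (a n * a n - a n) - 3)), ?_⟩
      rw [has, h1, hr]
      simp only [smul_mul_assoc, mul_smul_comm, smul_smul]
      congr 1
      ring
  have hdiff : ∀ n, ∃ r, a (n + 1) - a n = ϖ ^ (n + 1) • r := by
    intro n
    obtain ⟨r, hr⟩ := hstep n
    refine ⟨r - 2 * a n * r, ?_⟩
    have h1 : t (a n) - a n = (a n * a n - a n) - 2 * a n * (a n * a n - a n) := by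
      simp only [t]
      noncomm_ring
    rw [has, h1, hr, smul_sub, mul_smul_comm]
  obtain ⟨P, hP⟩ := Module.Free.exists_limit hc a (fun n ↦ by
    obtain ⟨r, hr⟩ := hdiff n
    exact ⟨ϖ • r, by rw [hr, pow_succ, mul_smul]⟩)
  refine ⟨P, ?_, ?_, fun x hx ↦ ?_⟩
  · refine sub_eq_zero.1 (eq_zero_of_forall_exists_eq_pow_smul hϖ fun n ↦ ?_)
    obtain ⟨r, hr⟩ := hP n
    obtain ⟨s, hs⟩ := hstep n
    refine ⟨r * P + a n * r + ϖ • s - r, ?_⟩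
    have h1 : P * P - P = (P - a n) * P + a n * (P - a n) + (a n * a n - a n) - (P - a n) := by
      noncomm_ring
    rw [h1, hs, hr]
    simp only [smul_add, smul_sub, smul_mul_assoc, mul_smul_comm, smul_smul, pow_succ]
  · obtain ⟨r, hr⟩ := hP 1
    obtain ⟨s, hs⟩ := hdiff 0
    refine ⟨r + s, ?_⟩
    rw [smul_add, ← pow_one ϖ, ← hr]
    rw [zero_add] at hs
    rw [← hs, ha0, sub_add_sub_cancel]
  · refine sub_eq_zero.1 (eq_zero_of_forall_exists_eq_pow_smul hϖ fun n ↦ ?_)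
    obtain ⟨r, hr⟩ := hP n
    refine ⟨x * r - r * x, ?_⟩
    have hxa : ∀ n, Commute x (a n) := by
      intro n
      induction n with
      | zero => exact hx
      | succ n ih =>
        rw [has]
        have h2 := ih.mul_right ih
        exact ((Nat.cast_commute 3 x).symm.mul_right h2).sub_right
          ((Nat.cast_commute 2 x).symm.mul_right (h2.mul_right ih))
    have h1 : x * P - P * x = x * (P - a n) - (P - a n) * x := by
      rw [mul_sub, sub_mul, (hxa n).eq]
      abel
    rw [h1, hr, smul_sub, mul_smul_comm, smul_mul_assoc]

end IsDiscreteValuationRing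

/-! ### Irreducible reduction for groups of invertible order. -/

namespace Submodule

section Projection

variable {O E : Type*} [CommRing O] [IsDomain O] [IsDiscreteValuationRing O] [AddCommGroup E]
  [Module O E] [Module.Free O E] [Module.Finite O E] {ϖ : O}

/-- Modulo the uniformizer, a submodule of a finite free module is the image of a projection. -/
theorem exists_projection_mod (hϖ : Irreducible ϖ) (S : Submodule O E) :
    ∃ p : Module.End O E, (∀ x, p x ∈ S) ∧ ∀ x ∈ S, ∃ y, p x - x = ϖ • y := by
  classical
  obtain ⟨n, ⟨b, c, φ, a, hsnf⟩⟩ := S.smithNormalForm (Module.Free.chooseBasis O E)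
  -- In Smith normal form the basis vectors with unit coefficient lie in `S` and span its image
  -- modulo `ϖ`; the other generators of `S` are divisible by `ϖ`.
  let p : Module.End O E := b.constr O fun j ↦ if ∃ i, φ i = j ∧ IsUnit (a i) then b j else 0
  have hp : ∀ j, p (b j) = if ∃ i, φ i = j ∧ IsUnit (a i) then b j else 0 :=
    fun j ↦ b.constr_basis O _ j
  refine ⟨p, fun x ↦ ?_, fun x hx ↦ ?_⟩
  · rw [← b.sum_repr x, map_sum]
    refine sum_mem fun j _ ↦ ?_
    rw [map_smul, hp]
    refine S.smul_mem _ ?_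
    split_ifs with h
    · obtain ⟨i, rfl, hi⟩ := h
      obtain ⟨v, hv⟩ := hi
      have h1 : b (φ i) = (v⁻¹ : Oˣ) • (c i : E) := by
        rw [hsnf, ← hv, ← Units.smul_def, inv_smul_smul]
      rw [h1]
      exact S.smul_mem _ (c i).2
    · exact S.zero_mem
  · obtain ⟨y, hy⟩ : ∃ y, (p - 1) x = ϖ • y := by
      have hxc : x = ∑ i, c.repr ⟨x, hx⟩ i • (c i : E) := by
        have := congrArg S.subtype (c.sum_repr ⟨x, hx⟩)
        rw [map_sum] at this
        exact this.symm
      have hci : ∀ i, ∃ y, (p - 1) (c i : E) = ϖ • y := by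
        intro i
        rw [hsnf]
        by_cases hi : IsUnit (a i)
        · refine ⟨0, ?_⟩
          rw [map_smul, LinearMap.sub_apply, hp, if_pos ⟨i, rfl, hi⟩]
          simp
        · have h1 : ϖ ∣ a i := by
            rw [← mem_nonunits_iff, ← IsLocalRing.mem_maximalIdeal, hϖ.maximalIdeal_eq,
              Ideal.mem_span_singleton] at hi
            exact hi
          obtain ⟨z, hz⟩ := h1
          exact ⟨z • (p - 1) (b (φ i)), by rw [map_smul, hz, mul_smul]⟩
      choose y hy using hci
      refine ⟨∑ i, c.repr ⟨x, hx⟩ i • y i, ?_⟩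
      conv_lhs => rw [hxc]
      rw [map_sum, Finset.smul_sum]
      exact Finset.sum_congr rfl fun i _ ↦ by rw [map_smul, hy, smul_comm]
    exact ⟨y, hy⟩

end Projection

end Submodule

namespace Representation

variable {O K N V : Type*} [CommRing O] [Field K] [Algebra O K] [AddCommGroup V] [Module K V]
  [Module O V] [IsScalarTower O K V] [Group N]

/-- The action of a group on a stable lattice. -/
def restrictLattice (ρ : Representation K N V) (T : Submodule O V)
    (hT : ∀ g, ∀ x ∈ T, ρ g x ∈ T) : N →* Module.End O T where
  toFun g := ((ρ g).restrictScalars O).restrict (hT g)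
  map_one' := by ext x; simp
  map_mul' g h := by ext x; simp; rfl

variable [IsDomain O] [IsDiscreteValuationRing O] [IsFractionRing O K]
  {ρ : Representation K N V}

/-- The integral version of Schur's lemma for idempotents. -/
theorem IsIrreducible.lattice_idempotent_eq_zero_or_one (h : ρ.IsIrreducible)
    (T : Submodule O V) [hTl : Submodule.IsLattice K T] (hT : ∀ g, ∀ x ∈ T, ρ g x ∈ T)
    {P : Module.End O T} (hP : ∀ g, Commute (ρ.restrictLattice T hT g) P)
    (hi : IsIdempotentElem P) : P = 0 ∨ P = 1 := by
  obtain ⟨-, hstab⟩ := (isIrreducible_iff_forall_stable ρ).1 h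
  -- The `K`-span of the image of `P` is stable, so it is zero or everything. In the second case the
  -- image is a lattice on which `P` is the identity, and torsion-freeness extends this to `T`.
  let S : Submodule O V := (LinearMap.range P).map T.subtype
  have hS : ∀ g, ∀ x ∈ Submodule.span K (S : Set V), ρ g x ∈ Submodule.span K (S : Set V) := by
    intro g x hx
    induction hx using Submodule.span_induction with
    | mem x hx =>
      obtain ⟨_, ⟨y, rfl⟩, rfl⟩ := hx
      refine Submodule.subset_span ⟨P (ρ.restrictLattice T hT g y), ⟨_, rfl⟩, ?_⟩
      have := LinearMap.congr_fun (hP g) y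
      exact congrArg Subtype.val this.symm
    | zero => simp
    | add x y _ _ hx hy => rw [map_add]; exact add_mem hx hy
    | smul a x _ hx => rw [map_smul]; exact Submodule.smul_mem _ _ hx
  rcases hstab _ hS with h0 | h1
  · left
    ext x
    have : (P x : V) ∈ Submodule.span K (S : Set V) := Submodule.subset_span ⟨P x, ⟨x, rfl⟩, rfl⟩
    rwa [h0, Submodule.mem_bot] at this
  · right
    have hfg : S.FG := by
      have := Submodule.IsLattice.finite K T
      exact (Module.Finite.fg_top (R := O) (M := T)).map P |>.map T.subtype |> fun h ↦ by
        rwa [Submodule.map_top] at h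
    have hSl : Submodule.IsLattice K S := ⟨hfg, h1⟩
    obtain ⟨ϖ, hϖ⟩ := IsDiscreteValuationRing.exists_irreducible O
    ext x
    obtain ⟨k, y, ⟨z, rfl⟩, hz⟩ := Submodule.exists_pow_smul_mem (K := K) hϖ S (x : V)
    have h2 : P z = ϖ ^ k • x := Subtype.ext hz
    have h3 : ϖ ^ k • P x = ϖ ^ k • x := by
      rw [← map_smul, ← h2]
      exact LinearMap.congr_fun hi z
    have h4 := Submodule.IsLattice.free K T
    have h5 : P x = x := smul_right_injective T (pow_ne_zero k hϖ.ne_zero) h3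
    rw [h5]
    rfl

/-- A lattice in an irreducible representation of a group whose order is invertible in the complete
discrete valuation ring has irreducible reduction. -/
theorem IsIrreducible.lattice_eq_or_eq [Finite N] (h : ρ.IsIrreducible) {ϖ : O}
    (hϖ : Irreducible ϖ)
    (hc : ∀ a : ℕ → O, (∀ n, ϖ ^ n ∣ a (n + 1) - a n) → ∃ L, ∀ n, ϖ ^ n ∣ L - a n)
    (hcard : IsUnit (Nat.card N : O)) (T : Submodule O V) [hTl : Submodule.IsLattice K T]
    (hT : ∀ g, ∀ x ∈ T, ρ g x ∈ T) (S : Submodule O V) (hS : ∀ g, ∀ x ∈ S, ρ g x ∈ S)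
    (hST : S ≤ T) (hϖS : ∀ x ∈ T, ϖ • x ∈ S) : (∀ x ∈ S, ∃ y ∈ T, x = ϖ • y) ∨ S = T := by
  have := Fintype.ofFinite N
  have := Submodule.IsLattice.free K T
  have := Submodule.IsLattice.finite K T
  let σ := ρ.restrictLattice T hT
  have hσ : ∀ g h, σ g * σ h = σ (g * h) := fun g h ↦ (map_mul σ g h).symm
  have hσ1 : σ 1 = 1 := map_one σ
  let S' : Submodule O T := S.comap T.subtype
  have hS' : ∀ g, ∀ x ∈ S', σ g x ∈ S' := fun g x hx ↦ hS g x hx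
  obtain ⟨p, hp1, hp2⟩ := Submodule.exists_projection_mod hϖ S'
  obtain ⟨c, hcN⟩ := hcard.exists_left_inv
  -- Maschke's average: still a projection onto `S` modulo `ϖ`, and now commuting with `N`. It lifts
  -- to an honest idempotent `Q`, which irreducibility over `K` forces to be `0` or `1`.
  let P : Module.End O T := c • ∑ g, σ g * p * σ g⁻¹
  have hPapply : ∀ x, P x = c • ∑ g, σ g (p (σ g⁻¹ x)) := by
    intro x
    simp [P, LinearMap.sum_apply]
  have hP1 : ∀ x, P x ∈ S' := by
    intro x
    rw [hPapply]
    exact S'.smul_mem _ (sum_mem fun g _ ↦ hS' g _ (hp1 _))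
  have hP2 : ∀ x ∈ S', ∃ y, P x - x = ϖ • y := by
    intro x hx
    have h1 : ∀ g, ∃ y, σ g (p (σ g⁻¹ x)) - x = ϖ • y := by
      intro g
      obtain ⟨y, hy⟩ := hp2 _ (hS' g⁻¹ x hx)
      refine ⟨σ g y, ?_⟩
      have h2 : σ g (σ g⁻¹ x) = x := by
        rw [← Module.End.mul_apply, hσ, mul_inv_cancel, hσ1, Module.End.one_apply]
      rw [← map_smul, ← hy, map_sub, h2]
    choose y hy using h1
    refine ⟨c • ∑ g, y g, ?_⟩
    have h3 : x = c • ∑ _g : N, x := by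
      rw [Finset.sum_const, Finset.card_univ, ← Nat.card_eq_fintype_card,
        ← Nat.cast_smul_eq_nsmul O, smul_smul, hcN, one_smul]
    conv_lhs => rw [hPapply]; arg 2; rw [h3]
    rw [← smul_sub, ← Finset.sum_sub_distrib, smul_comm]
    simp_rw [hy, ← Finset.smul_sum]
  have hPσ : ∀ g, Commute (σ g) P := by
    intro g
    change σ g * (c • ∑ h, σ h * p * σ h⁻¹) = (c • ∑ h, σ h * p * σ h⁻¹) * σ g
    rw [mul_smul_comm, smul_mul_assoc, Finset.mul_sum, Finset.sum_mul]
    congr 1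
    refine Fintype.sum_equiv (Equiv.mulLeft g) _ _ fun h ↦ ?_
    simp only [Equiv.coe_mulLeft, mul_inv_rev, mul_assoc, hσ, inv_mul_cancel, mul_one]
    rw [← mul_assoc, hσ]
  have hPP : ∃ r, P * P - P = ϖ • r := by
    let b := Module.Free.chooseBasis O T
    choose y hy using fun i ↦ hP2 _ (hP1 (b i))
    refine ⟨b.constr O y, b.ext fun i ↦ ?_⟩
    rw [LinearMap.smul_apply, b.constr_basis, ← hy]
    rfl
  obtain ⟨r, hr⟩ := hPP
  obtain ⟨Q, hQ, ⟨s, hs⟩, hQcomm⟩ :=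
    IsDiscreteValuationRing.exists_isIdempotentElem hϖ hc hr
  -- Modulo `ϖ`, `P` is the identity on `S` and agrees with `Q`. So `Q = 0` gives `S ⊆ ϖ T`, and `Q
  -- = 1` gives `T ⊆ P T + ϖ T ⊆ S`.
  rcases h.lattice_idempotent_eq_zero_or_one T hT (fun g ↦ hQcomm _ (hPσ g)) hQ with rfl | rfl
  · left
    intro x hx
    obtain ⟨y, hy⟩ := hP2 ⟨x, hST hx⟩ hx
    have h1 : P ⟨x, hST hx⟩ = - ϖ • s ⟨x, hST hx⟩ := by
      have := LinearMap.congr_fun hs ⟨x, hST hx⟩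
      simp only [zero_sub, LinearMap.neg_apply, LinearMap.smul_apply] at this
      rw [neg_smul, ← this, neg_neg]
    refine ⟨_, (-(s ⟨x, hST hx⟩) - y).2, ?_⟩
    have h2 : (⟨x, hST hx⟩ : T) = ϖ • (-(s ⟨x, hST hx⟩) - y) := by
      rw [smul_sub, ← hy, h1]
      simp
    exact congrArg Subtype.val h2
  · right
    refine le_antisymm hST fun x hx ↦ ?_
    have h1 : (⟨x, hx⟩ : T) - P ⟨x, hx⟩ = ϖ • s ⟨x, hx⟩ := LinearMap.congr_fun hs ⟨x, hx⟩
    have h2 : (⟨x, hx⟩ : T) = P ⟨x, hx⟩ + ϖ • s ⟨x, hx⟩ := by rw [← h1, add_sub_cancel]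
    have h3 : x = (P ⟨x, hx⟩ : V) + ϖ • (s ⟨x, hx⟩ : V) := congrArg Subtype.val h2
    rw [h3]
    exact add_mem (hP1 _) (hϖS _ (s ⟨x, hx⟩).2)

end Representation

/-! ### The case in which `N` acts irreducibly. -/

namespace Submodule

variable {O K V : Type*} [CommRing O] [Field K] [Algebra O K] [AddCommGroup V] [Module K V]
  [Module O V] [IsScalarTower O K V]

/-- The dual of a stable lattice for an invariant form is stable. -/
theorem apply_mem_dualSubmodule {G : Type*} [Group G] {ρ : Representation K G V}
    {f : LinearMap.BilinForm K V} (hinv : ∀ (g : G) (x y : V), f (ρ g x) (ρ g y) = f x y)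
    {T : Submodule O V} (hT : ∀ g, ∀ x ∈ T, ρ g x ∈ T) (g : G) {x : V}
    (hx : x ∈ f.dualSubmodule T) : ρ g x ∈ f.dualSubmodule T := by
  rw [LinearMap.BilinForm.mem_dualSubmodule] at hx ⊢
  intro y hy
  have h1 := hx _ (hT g⁻¹ y hy)
  rwa [← hinv g, ← Module.End.mul_apply (ρ g) (ρ g⁻¹), ρ.apply_mul_apply_inv,
    Module.End.one_apply] at h1

variable [IsDomain O] [IsDiscreteValuationRing O] [IsFractionRing O K]

/-- If a symplectic representation of `G` is irreducible on a subgroup whose order is invertible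
in the complete discrete valuation ring, then each stable lattice carries a perfect form. -/
theorem exists_perfect_of_isIrreducible_restrict [FiniteDimensional K V] {G : Type*} [Group G]
    [Finite G] {ρ : Representation K G V} {f : LinearMap.BilinForm K V} (hf : f.Nondegenerate)
    (halt : f.IsAlt) (hinv : ∀ (g : G) (x y : V), f (ρ g x) (ρ g y) = f x y)
    (N : Subgroup G) (hN : Representation.IsIrreducible (ρ.comp N.subtype)) {ϖ : O}
    (hϖ : Irreducible ϖ)
    (hc : ∀ a : ℕ → O, (∀ n, ϖ ^ n ∣ a (n + 1) - a n) → ∃ L, ∀ n, ϖ ^ n ∣ L - a n)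
    (hcard : IsUnit (Nat.card N : O)) :
    ∃ (T : Submodule O V) (_ : IsLattice K T) (hT : ∀ (g : G), ∀ x ∈ T, ρ g x ∈ T)
      (f' : LinearMap.BilinForm O T), f'.IsPerfPair ∧ f'.IsAlt ∧
        ∀ (g : G) (x y : T), f' ⟨ρ g x, hT g x x.2⟩ ⟨ρ g y, hT g y y.2⟩ = f' x y := by
  obtain ⟨hnt, -⟩ := (Representation.isIrreducible_iff_forall_stable _).1 hN
  obtain ⟨T, hTl, hT⟩ := exists_isLattice_stable O ρ
  have hdual := isLattice_dualSubmodule hf T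
  have hϖ0 : algebraMap O K ϖ ≠ 0 := by
    rw [Ne, IsFractionRing.to_map_eq_zero_iff]; exact hϖ.ne_zero
  let w : Kˣ := Units.mk0 _ hϖ0
  -- The chain lemma is applied to the homothety by `ϖ`, with `M = 1`: the dual of `T` is then `ϖ ^
  -- i T`.
  let u : (Module.End K V)ˣ := Units.map (algebraMap K (Module.End K V)).toMonoidHom w
  have hu : ∀ (i : ℤ) (x : V), u ^ i • x = (algebraMap O K ϖ) ^ i • x := by
    intro i x
    have : u ^ i = Units.map (algebraMap K (Module.End K V)).toMonoidHom (w ^ i) :=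
      (map_zpow _ w i).symm
    rw [this, ← Units.val_mk0 hϖ0, ← Units.val_zpow_eq_zpow_val]
    rfl
  have hu1 : ∀ x : V, u • x = ϖ • x := by
    intro x
    rw [← algebraMap_smul K ϖ x, ← zpow_one (algebraMap O K ϖ), ← hu, zpow_one]
  obtain ⟨i, hi⟩ := exists_eq_zpow_smul (T' := f.dualSubmodule T) hϖ
    (Set.range (ρ.comp N.subtype)) (u := u) (T := T) (M := 1)
    (by rintro s -; exact (Algebra.commutes (w : K) s).symm)
    (by rintro _ ⟨g, rfl⟩ x hx; exact hT g x hx)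
    (by intro x hx; exact ⟨x, hx, by rw [pow_one, hu1]⟩)
    (by
      intro S hS h1 h2
      rcases hN.lattice_eq_or_eq hϖ hc hcard T (fun g x hx ↦ hT g x hx) S
        (fun g x hx ↦ hS _ ⟨g, rfl⟩ x hx) h2
        (fun x hx ↦ h1 (hu1 x ▸ smul_mem_pointwise_smul x u T hx)) with h | h
      · left
        refine le_antisymm (fun x hx ↦ ?_) h1
        obtain ⟨y, hy, rfl⟩ := h x hx
        exact hu1 y ▸ smul_mem_pointwise_smul y u T hy
      · exact Or.inr h)
    (by
      rintro _ ⟨x, hx, rfl⟩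
      have := T.smul_mem ϖ hx
      rwa [← hu1] at this)
    (by rintro _ ⟨g, rfl⟩ x hx; exact apply_mem_dualSubmodule hinv hT g hx)
    (by
      rintro _ ⟨x, hx, rfl⟩
      have := Submodule.smul_mem _ ϖ hx
      rwa [← hu1] at this)
  have hp0 : (algebraMap O K ϖ) ^ i ≠ 0 := zpow_ne_zero i hϖ0
  -- Multiplying the form by `ϖ ^ i` turns the dual `ϖ ^ i T` into `T` itself.
  refine exists_perfect_of_dualSubmodule_eq (f := (algebraMap O K ϖ) ^ i • f) (ρ := ρ) ?_ ?_ ?_ T hT ?_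
  · refine ⟨fun x hx ↦ hf.1 x fun y ↦ ?_, fun y hy ↦ hf.2 y fun x ↦ ?_⟩
    · exact (smul_eq_zero.1 (hx y)).resolve_left hp0
    · exact (smul_eq_zero.1 (hy x)).resolve_left hp0
  · intro x
    rw [LinearMap.smul_apply, LinearMap.smul_apply, halt x, smul_zero]
  · intro g x y
    simp only [LinearMap.smul_apply, hinv]
  · ext x
    have h1 : x ∈ ((algebraMap O K ϖ) ^ i • f).dualSubmodule T ↔
        u ^ i • x ∈ f.dualSubmodule T := by
      simp only [LinearMap.BilinForm.mem_dualSubmodule, hu, LinearMap.smul_apply, map_smul]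
    rw [h1, hi, mem_units_smul_iff, inv_smul_smul]

end Submodule

/-! ### Determinants of the `1 - ζ ^ i`. -/

section Determinant

variable {O E : Type*} [CommRing O] [AddCommGroup E] [Module O E]

/-- For an endomorphism `Z` with `Z ^ ℓ = 1`, the determinants of the `1 - Z ^ i`, for `i` prime to
`ℓ`, are associated. -/
theorem LinearMap.associated_det_one_sub_pow [IsDomain O] {Z : Module.End O E} {ℓ i : ℕ}
    (hℓ : 1 < ℓ) (hZ : Z ^ ℓ = 1) (hi : i.Coprime ℓ) :
    Associated (LinearMap.det (1 - Z ^ i)) (LinearMap.det (1 - Z)) := by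
  -- The geometric sum shows that `1 - Y` divides `1 - Y ^ n`. This is used for `Z` and for `Z ^ i`,
  -- of which `Z` is a power.
  have key : ∀ (Y : Module.End O E) (n : ℕ), LinearMap.det (1 - Y) ∣ LinearMap.det (1 - Y ^ n) :=
    fun Y n ↦ ⟨LinearMap.det (∑ k ∈ Finset.range n, Y ^ k), by
      rw [← map_mul, mul_neg_geom_sum]⟩
  refine associated_of_dvd_dvd ?_ (key Z i)
  obtain ⟨j, -, hj⟩ := Nat.exists_mul_mod_eq_one_of_coprime hi hℓ
  have h1 : (Z ^ i) ^ j = Z := by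
    rw [← pow_mul, ← Nat.div_add_mod (i * j) ℓ, hj, pow_add, pow_mul, hZ, one_pow, one_mul, pow_one]
  have := key (Z ^ i) j
  rwa [h1] at this

/-- If the determinant of `U` is irreducible, then the cokernel of `U` is simple. -/
theorem LinearMap.eq_range_or_eq_top_of_irreducible_det [IsDomain O] [IsPrincipalIdealRing O]
    [Module.Free O E] [Module.Finite O E] {U : Module.End O E} (hU : Irreducible (LinearMap.det U))
    {S : Submodule O E} (hS : LinearMap.range U ≤ S) : S = LinearMap.range U ∨ S = ⊤ := by
  have hinj : Function.Injective U := by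
    rw [← LinearMap.ker_eq_bot]
    by_contra hk
    exact hU.ne_zero (LinearMap.det_eq_zero_iff_ker_ne_bot.2 hk)
  have hrank : Module.finrank O S = Module.finrank O E := by
    refine le_antisymm (Submodule.finrank_le S) ?_
    rw [← LinearMap.finrank_range_of_inj hinj]
    exact Submodule.finrank_mono hS
  -- `S` is free of full rank, so `U` factors through an endomorphism `A` with image `S`. As `det U`
  -- is irreducible, one of the two factors is invertible.
  let φ : E ≃ₗ[O] S := LinearEquiv.ofFinrankEq E S hrank.symm
  let A : Module.End O E := S.subtype ∘ₗ φ.toLinearMap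
  let B : Module.End O E := φ.symm.toLinearMap ∘ₗ U.codRestrict S fun x ↦ hS ⟨x, rfl⟩
  have hAB : A * B = U := by
    ext x
    simp [A, B]
  have hB : ∀ x, (φ (B x) : E) = U x := by
    intro x
    simp [B]
  rw [← hAB, map_mul] at hU
  rcases hU.isUnit_or_isUnit rfl with h | h
  · right
    obtain ⟨-, hs⟩ := (Module.End.isUnit_iff A).1 ((LinearMap.isUnit_iff_isUnit_det A).2 h)
    rw [eq_top_iff]
    intro x _
    obtain ⟨y, rfl⟩ := hs x
    exact (φ y).2
  · left
    obtain ⟨-, hs⟩ := (Module.End.isUnit_iff B).1 ((LinearMap.isUnit_iff_isUnit_det B).2 h)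
    refine le_antisymm (fun x hx ↦ ?_) hS
    obtain ⟨y, hy⟩ := hs (φ.symm ⟨x, hx⟩)
    refine ⟨y, ?_⟩
    rw [← hB, hy, LinearEquiv.apply_symm_apply]

/-- The `ℓ`-th power of the difference of two powers of `Z` is divisible by `ℓ` if `Z ^ ℓ = 1`. -/
theorem exists_sub_pow_prime_eq_smul {R : Type*} [Ring R] {Z : R} {ℓ : ℕ} (hℓ : ℓ.Prime)
    (hodd : ℓ ≠ 2) (hZ : Z ^ ℓ = 1) (a b : ℕ) : ∃ r : R, (Z ^ a - Z ^ b) ^ ℓ = (ℓ : R) * r := by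
  -- The mixed binomial terms are divisible by `ℓ`; for odd `ℓ` the outer two are `1` and `-1`.
  have hcomm : Commute (Z ^ a) (-Z ^ b) := ((Commute.refl Z).pow_pow a b).neg_right
  obtain ⟨r, hr⟩ := hcomm.exists_add_pow_prime_eq hℓ
  refine ⟨Z ^ a * -Z ^ b * r, ?_⟩
  rw [(hℓ.odd_of_ne_two hodd).neg_pow, ← pow_mul, ← pow_mul, mul_comm a, mul_comm b, pow_mul, pow_mul,
    hZ, one_pow, one_pow, add_neg_cancel, zero_add] at hr
  rw [sub_eq_add_neg, hr]
  simp only [mul_assoc]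

end Determinant

/-- The product formula for the determinants of `1 - ζ ^ i` if `ζ` is a primitive root of unity
in a commutative domain of endomorphisms. -/
theorem LinearMap.prod_det_one_sub_pow {K V : Type*} [Field K] [CharZero K] [AddCommGroup V]
    [Module K V] {ζ : Module.End K V} {ℓ : ℕ} (hℓ : ℓ.Prime) (hζ : ζ ^ ℓ = 1) (hζ1 : ζ ≠ 1)
    (hdom : ∀ p q : K[X], Polynomial.aeval ζ p * Polynomial.aeval ζ q = 0 →
      Polynomial.aeval ζ p = 0 ∨ Polynomial.aeval ζ q = 0) [Nontrivial V] :
    ∏ k ∈ Finset.range (ℓ - 1), LinearMap.det (1 - ζ ^ (k + 1)) =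
      (ℓ : K) ^ Module.finrank K V := by
  -- The image of `φ` is a domain in which `ζ` is a primitive `ℓ`-th root of unity, so the product
  -- of the `1 - ζ ^ i` is `ℓ` there; the determinant is then taken.
  let φ : K[X] →+* Module.End K V := (Polynomial.aeval ζ).toRingHom
  have hprime : (RingHom.ker φ).IsPrime := by
    refine ⟨fun h ↦ ?_, fun {p q} hpq ↦ ?_⟩
    · have : (1 : K[X]) ∈ RingHom.ker φ := h ▸ Submodule.mem_top
      rw [RingHom.mem_ker, map_one] at this
      exact one_ne_zero this
    · rw [RingHom.mem_ker, map_mul] at hpq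
      exact hdom p q hpq
  let ι : K[X] ⧸ RingHom.ker φ →+* Module.End K V := RingHom.kerLift φ
  have hι : Function.Injective ι := RingHom.kerLift_injective φ
  let z : K[X] ⧸ RingHom.ker φ := Ideal.Quotient.mk _ Polynomial.X
  have hz : ι z = ζ := by
    change φ Polynomial.X = ζ
    exact Polynomial.aeval_X ζ
  have hzprim : IsPrimitiveRoot z (ℓ - 1 + 1) := by
    rw [Nat.sub_add_cancel hℓ.one_lt.le, IsPrimitiveRoot.iff_orderOf]
    have := Fact.mk hℓ
    refine orderOf_eq_prime (hι ?_) (fun h ↦ hζ1 ?_)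
    · rw [map_pow, hz, hζ, map_one]
    · rw [← hz, h, map_one]
  have h1 := congrArg ι hzprim.prod_one_sub_pow_eq_order
  have h2 := congrArg LinearMap.det h1
  have h3 : ∀ s : Finset ℕ, LinearMap.det (ι (∏ k ∈ s, (1 - z ^ (k + 1)))) =
      ∏ k ∈ s, LinearMap.det (1 - ζ ^ (k + 1)) := by
    intro s
    rw [← hz]
    simp only [← map_pow, ← map_one ι, ← map_sub]
    exact map_prod (LinearMap.det.comp ι.toMonoidHom) _ s
  rw [h3] at h2
  rw [h2, ← Nat.cast_succ, Nat.succ_eq_add_one, Nat.sub_add_cancel hℓ.one_lt.le, map_natCast]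
  have h4 : (ℓ : Module.End K V) = (ℓ : K) • LinearMap.id := by
    ext x
    simp [Module.End.natCast_apply, Nat.cast_smul_eq_nsmul]
  rw [h4, LinearMap.det_smul, LinearMap.det_id, mul_one]

namespace Submodule

variable {O K V : Type*} [CommRing O] [Field K] [Algebra O K] [AddCommGroup V] [Module K V]
  [Module O V] [IsScalarTower O K V]

/-- The restriction of an endomorphism to a stable submodule over a subring. -/
def restrictEnd (T : Submodule O V) (x : Module.End K V) (hx : ∀ v ∈ T, x v ∈ T) :
    Module.End O T :=
  (x.restrictScalars O).restrict hx

theorem coe_restrictEnd_apply (T : Submodule O V) (x : Module.End K V) (hx : ∀ v ∈ T, x v ∈ T)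
    (v : T) : (T.restrictEnd x hx v : V) = x v := rfl

variable [IsDomain O] [IsDiscreteValuationRing O] [IsFractionRing O K]

/-- The determinant can be computed on a lattice. -/
theorem algebraMap_det_restrictEnd (T : Submodule O V) [IsLattice K T] (x : Module.End K V)
    (hx : ∀ v ∈ T, x v ∈ T) :
    algebraMap O K (LinearMap.det (T.restrictEnd x hx)) = LinearMap.det x := by
  classical
  have := IsLattice.free K T
  have := IsLattice.finite K T
  let b := Module.Free.chooseBasis O T
  let bK := b.extendOfIsLattice K
  rw [← LinearMap.det_toMatrix b, ← LinearMap.det_toMatrix bK, RingHom.map_det]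
  congr 1
  ext i j
  rw [RingHom.mapMatrix_apply, Matrix.map_apply, LinearMap.toMatrix_apply, LinearMap.toMatrix_apply]
  have h1 : ∀ v : T, bK.repr (v : V) i = algebraMap O K (b.repr v i) := by
    intro v
    have h2 : (v : V) = ∑ i, algebraMap O K (b.repr v i) • bK i := by
      have h3 := congrArg T.subtype (b.sum_repr v)
      rw [map_sum] at h3
      conv_lhs => rw [← T.subtype_apply v, ← h3]
      refine Finset.sum_congr rfl fun i _ ↦ ?_
      rw [algebraMap_smul, b.extendOfIsLattice_apply K]
      rfl
    rw [h2, bK.repr_sum_self]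
  have h4 : bK j = (b j : V) := b.extendOfIsLattice_apply K j
  rw [← h1, coe_restrictEnd_apply, h4]

end Submodule

/-! ### The bound on `ℓ` makes `det (1 - ζ)` a uniformizer. -/

namespace Submodule

theorem pow_apply_mem {O K V : Type*} [CommRing O] [Field K] [AddCommGroup V] [Module K V]
    [Module O V] {T : Submodule O V} {x : Module.End K V} (hx : ∀ v ∈ T, x v ∈ T)
    (n : ℕ) : ∀ v ∈ T, (x ^ n) v ∈ T := by
  induction n with
  | zero => exact fun v hv ↦ hv
  | succ n ih =>
    intro v hv
    rw [pow_succ]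
    exact ih _ (hx v hv)

variable {O K V : Type*} [CommRing O] [Field K] [Algebra O K] [AddCommGroup V] [Module K V]
  [Module O V] [IsScalarTower O K V]

theorem coe_restrictEnd_pow_apply (T : Submodule O V) (x : Module.End K V)
    (hx : ∀ v ∈ T, x v ∈ T) (n : ℕ) (v : T) : ((T.restrictEnd x hx ^ n) v : V) = (x ^ n) v := by
  induction n generalizing v with
  | zero => rfl
  | succ n ih =>
    rw [pow_succ, pow_succ, Module.End.mul_apply, ih]
    rfl

theorem restrictEnd_pow_eq_one {T : Submodule O V} {x : Module.End K V}
    (hx : ∀ v ∈ T, x v ∈ T) {n : ℕ} (h : x ^ n = 1) : T.restrictEnd x hx ^ n = 1 := by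
  ext v
  rw [coe_restrictEnd_pow_apply, h]
  rfl

/-- An automorphism that is a difference of powers of an automorphism of order `ℓ` of a lattice
is topologically nilpotent. -/
theorem exists_pow_smul_eq_of_eq_sub {ϖ : O} {T : Submodule O V} {ζ : Module.End K V}
    (hζT : ∀ v ∈ T, ζ v ∈ T) {ℓ : ℕ} (hℓ : ℓ.Prime) (hodd : ℓ ≠ 2) (hϖℓ : ϖ ∣ (ℓ : O))
    (hζ : ζ ^ ℓ = 1) {a b : ℕ} {u : (Module.End K V)ˣ}
    (hu : (u : Module.End K V) = ζ ^ a - ζ ^ b) :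
    ∀ x ∈ T, ∃ y ∈ T, u ^ ℓ • x = ϖ • y := by
  intro x hx
  obtain ⟨r, hr⟩ := exists_sub_pow_prime_eq_smul hℓ hodd (restrictEnd_pow_eq_one hζT hζ) a b
  obtain ⟨c, hc⟩ := hϖℓ
  have hstable : ∀ v ∈ T, (u : Module.End K V) v ∈ T := by
    intro v hv
    rw [hu]
    exact sub_mem (pow_apply_mem hζT a v hv) (pow_apply_mem hζT b v hv)
  have hres : T.restrictEnd (u : Module.End K V) hstable =
      T.restrictEnd ζ hζT ^ a - T.restrictEnd ζ hζT ^ b := by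
    ext v
    rw [coe_restrictEnd_apply, LinearMap.sub_apply, AddSubgroupClass.coe_sub, coe_restrictEnd_pow_apply,
      coe_restrictEnd_pow_apply, hu, LinearMap.sub_apply]
  rw [← hres] at hr
  refine ⟨(c • r ⟨x, hx⟩ : T), (c • r ⟨x, hx⟩ : T).2, ?_⟩
  have h1 := congrArg Subtype.val (LinearMap.congr_fun hr ⟨x, hx⟩)
  rw [coe_restrictEnd_pow_apply] at h1
  have h2 : ((ℓ : Module.End O T) * r) ⟨x, hx⟩ = ϖ • c • r ⟨x, hx⟩ := by
    rw [Module.End.mul_apply, Module.End.natCast_apply, ← Nat.cast_smul_eq_nsmul O, hc, mul_smul]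
  rw [h2] at h1
  rw [Units.smul_def, Units.val_pow_eq_pow_val]
  exact h1

variable [IsDomain O] [IsDiscreteValuationRing O]

/-- If the determinant of `u` on the lattice `T` is irreducible, then `T / u T` is simple. -/
theorem eq_or_eq_of_irreducible_det [IsFractionRing O K] {T : Submodule O V} [IsLattice K T]
    {u : (Module.End K V)ˣ}
    (hu : ∀ v ∈ T, (u : Module.End K V) v ∈ T)
    (hdet : Irreducible (LinearMap.det (T.restrictEnd (u : Module.End K V) hu)))
    {S : Submodule O V} (h1 : u • T ≤ S) (h2 : S ≤ T) : S = u • T ∨ S = T := by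
  have := IsLattice.free K T
  have := IsLattice.finite K T
  rcases LinearMap.eq_range_or_eq_top_of_irreducible_det hdet (S := S.comap T.subtype) (by
    rintro _ ⟨v, rfl⟩
    exact h1 ⟨v, v.2, rfl⟩) with h | h
  · left
    refine le_antisymm (fun x hx ↦ ?_) h1
    have h3 : (⟨x, h2 hx⟩ : T) ∈ S.comap T.subtype := hx
    rw [h] at h3
    obtain ⟨y, hy⟩ := h3
    exact ⟨y, y.2, congrArg Subtype.val hy⟩
  · right
    refine le_antisymm h2 fun x hx ↦ ?_
    have h3 : (⟨x, hx⟩ : T) ∈ S.comap T.subtype := h ▸ mem_top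
    exact h3

/-- A topologically nilpotent automorphism does not map a lattice onto itself. -/
theorem not_le_units_smul [Nontrivial V] {ϖ : O} (hϖ : Irreducible ϖ) {u : (Module.End K V)ˣ}
    {T : Submodule O V} [hT : IsLattice K T] {M : ℕ}
    (hM : ∀ x ∈ T, ∃ y ∈ T, u ^ M • x = ϖ • y) : ¬ T ≤ u • T := by
  intro hle
  have hpow : ∀ n : ℕ, T ≤ u ^ n • T := by
    intro n
    induction n with
    | zero => rw [pow_zero, one_smul]
    | succ n ih =>
      rw [pow_succ, mul_smul]
      exact ih.trans (units_smul_mono _ hle)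
  have h2 : T ≤ ⊥ := by
    refine le_of_forall_exists_add_smul hϖ hT.fg fun x hx ↦ ?_
    obtain ⟨z, hz, rfl⟩ := hpow M hx
    obtain ⟨y, hy, hzy⟩ := hM z hz
    exact ⟨0, zero_mem _, y, hy, by rw [zero_add, ← hzy]; rfl⟩
  have h3 := hT.span_eq_top
  rw [le_bot_iff.1 h2, bot_coe, span_zero_singleton] at h3
  exact bot_ne_top h3

variable [IsFractionRing O K]

/-- Let `ζ` be an automorphism of order `ℓ` of a lattice of rank `2 d` which generates a field, and
let `ℓ > d e + 1`, where `e` is the valuation of `ℓ`. Then the determinant of `1 - ζ` is a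
uniformizer. -/
theorem associated_det_one_sub [CharZero K] [FiniteDimensional K V] [Nontrivial V] {ϖ : O}
    (hϖ : Irreducible ϖ)
    {ℓ e d : ℕ} (hℓ : ℓ.Prime) (he : Associated (ℓ : O) (ϖ ^ e)) (he0 : e ≠ 0)
    (hd : Module.finrank K V = 2 * d) (hlt : d * e + 1 < ℓ) (T : Submodule O V) [IsLattice K T]
    {ζ : Module.End K V} (hζT : ∀ v ∈ T, ζ v ∈ T) (hζ : ζ ^ ℓ = 1) (hζ1 : ζ ≠ 1)
    (hdom : ∀ p q : K[X], Polynomial.aeval ζ p * Polynomial.aeval ζ q = 0 →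
      Polynomial.aeval ζ p = 0 ∨ Polynomial.aeval ζ q = 0) :
    Associated (LinearMap.det (1 - T.restrictEnd ζ hζT)) ϖ := by
  set Z := T.restrictEnd ζ hζT with hZ
  have hd0 : d ≠ 0 := by
    rintro rfl
    have := Module.finrank_pos (R := K) (M := V)
    lia
  have hdet : ∀ k : ℕ, algebraMap O K (LinearMap.det (1 - Z ^ k)) = LinearMap.det (1 - ζ ^ k) := by
    intro k
    have hs : ∀ v ∈ T, (1 - ζ ^ k) v ∈ T := fun v hv ↦ sub_mem hv (pow_apply_mem hζT k v hv)
    rw [← algebraMap_det_restrictEnd T _ hs]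
    congr 2
    ext v
    rw [coe_restrictEnd_apply, LinearMap.sub_apply, LinearMap.sub_apply,
      AddSubgroupClass.coe_sub,
      coe_restrictEnd_pow_apply]
    rfl
  have hprod : ∏ k ∈ Finset.range (ℓ - 1), LinearMap.det (1 - Z ^ (k + 1)) =
      (ℓ : O) ^ (2 * d) := by
    apply IsFractionRing.injective O K
    rw [map_prod, map_pow, map_natCast, ← hd, ← LinearMap.prod_det_one_sub_pow hℓ hζ hζ1 hdom]
    exact Finset.prod_congr rfl fun k _ ↦ hdet (k + 1)
  -- The `ℓ - 1` factors of the product are all associated to `det (1 - Z)`.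
  have hass : Associated (LinearMap.det (1 - Z) ^ (ℓ - 1)) (ϖ ^ (e * (2 * d))) := by
    rw [pow_mul]
    refine Associated.trans ?_ (he.pow_pow (n := 2 * d))
    rw [← hprod, ← Finset.card_range (ℓ - 1), ← Finset.prod_const, Finset.card_range]
    refine Associated.prod _ _ _ fun k hk ↦ ?_
    refine (LinearMap.associated_det_one_sub_pow hℓ.one_lt (restrictEnd_pow_eq_one hζT hζ) ?_).symm
    rw [Finset.mem_range] at hk
    exact (Nat.coprime_of_lt_prime (by lia) (by lia) hℓ).symm
  have hne : LinearMap.det (1 - Z) ≠ 0 := by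
    intro h0
    rw [h0, zero_pow (by have := hℓ.two_le; lia)] at hass
    exact pow_ne_zero _ hϖ.ne_zero (hass.symm.eq_zero_iff.2 rfl)
  obtain ⟨w, hw⟩ := IsDiscreteValuationRing.associated_pow_irreducible hne hϖ
  have h1 : Associated (ϖ ^ (w * (ℓ - 1))) (ϖ ^ (e * (2 * d))) := by
    rw [pow_mul]
    exact hw.symm.pow_pow.trans hass
  have h2 : w * (ℓ - 1) = e * (2 * d) :=
    le_antisymm ((pow_dvd_pow_iff hϖ.ne_zero hϖ.not_isUnit).1 h1.dvd)
      ((pow_dvd_pow_iff hϖ.ne_zero hϖ.not_isUnit).1 h1.symm.dvd)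
  -- From `w (ℓ - 1) = 2 d e` and `0 < d e < ℓ - 1` follows `0 < w < 2`.
  have h3 : w = 1 := by
    obtain ⟨m, rfl⟩ : ∃ m, ℓ = m + 1 := ⟨ℓ - 1, by lia⟩
    rw [Nat.add_sub_cancel] at h2
    have h4 : d * e < m := by lia
    have h5 : 0 < d * e := Nat.mul_pos (by lia) (by lia)
    have h6 : w * m = 2 * (d * e) := by rw [h2]; ring
    have h7 : w < 2 := by
      by_contra! h
      nlinarith
    have h8 : w ≠ 0 := by rintro rfl; lia
    lia
  rwa [h3, pow_one] at hw

end Submodule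

/-! ### The centralizer of `ζ` is commutative. -/

/-- Whatever commutes with an element commutes with the polynomials in it. -/
theorem Commute.aeval_right {R A : Type*} [CommSemiring R] [Semiring A] [Algebra R A] {z x : A}
    (h : Commute z x) (p : R[X]) : Commute z (Polynomial.aeval x p) := by
  induction p using Polynomial.induction_on' with
  | add p q hp hq => rw [map_add]; exact hp.add_right hq
  | monomial n a =>
    rw [Polynomial.aeval_monomial]
    exact (Algebra.commute_algebraMap_right a z).mul_right (h.pow_right n)

namespace Submodule

variable {O K V : Type*} [CommRing O] [IsDomain O] [IsDiscreteValuationRing O] [Field K]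
  [Algebra O K] [IsFractionRing O K] [AddCommGroup V] [Module K V] [Module O V]
  [IsScalarTower O K V]

variable (O) in
/-- Let `ζ` have order `ℓ` and generate a field, in dimension `2 d` with `ℓ > d e + 1`, where `e`
is the valuation of `ℓ`. Then the endomorphisms that commute with `ζ` commute with each other. -/
theorem commute_of_commute [CharZero K] [FiniteDimensional K V] [Nontrivial V] {ϖ : O}
    (hϖ : Irreducible ϖ)
    {ℓ e d : ℕ} (hℓ : ℓ.Prime) (hodd : ℓ ≠ 2) (he : Associated (ℓ : O) (ϖ ^ e)) (he0 : e ≠ 0)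
    (hd : Module.finrank K V = 2 * d) (hlt : d * e + 1 < ℓ)
    {ζ : Module.End K V} (hζ : ζ ^ ℓ = 1) (hζ1 : ζ ≠ 1) (hunit : IsUnit (1 - ζ))
    (hdom : ∀ p q : K[X], Polynomial.aeval ζ p * Polynomial.aeval ζ q = 0 →
      Polynomial.aeval ζ p = 0 ∨ Polynomial.aeval ζ q = 0)
    {x y : Module.End K V} (hx : Commute x ζ) (hy : Commute y ζ) : Commute x y := by
  have : Finite (Submonoid.powers ζ) := by
    have h1 : IsOfFinOrder ζ := isOfFinOrder_iff_pow_eq_one.2 ⟨ℓ, hℓ.pos, hζ⟩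
    exact h1.finite_powers
  obtain ⟨T, hTl, hT⟩ := exists_isLattice_stable O (Submonoid.powers ζ).subtype
  have hζT : ∀ v ∈ T, ζ v ∈ T := fun v hv ↦ hT ⟨ζ, Submonoid.mem_powers ζ⟩ v hv
  obtain ⟨u, hu⟩ := hunit
  have huT : ∀ v ∈ T, (u : Module.End K V) v ∈ T := fun v hv ↦ by
    rw [hu]; exact sub_mem hv (hζT v hv)
  have hass := associated_det_one_sub hϖ hℓ he he0 hd hlt T hζT hζ hζ1 hdom
  have hdet : Irreducible (LinearMap.det (T.restrictEnd (u : Module.End K V) huT)) := by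
    have h1 : T.restrictEnd (u : Module.End K V) huT = 1 - T.restrictEnd ζ hζT := by
      ext v
      change (u : Module.End K V) v = _
      rw [hu]
      rfl
    rw [h1]
    exact hass.symm.irreducible hϖ
  have hϖℓ : ϖ ∣ (ℓ : O) := (dvd_pow_self ϖ he0).trans he.symm.dvd
  have hM := exists_pow_smul_eq_of_eq_sub hζT hℓ hodd hϖℓ hζ (a := 0) (b := 1) (u := u)
    (by rw [hu, pow_zero, pow_one])
  have huT' : u • T ≤ T := by
    rintro _ ⟨v, hv, rfl⟩
    exact huT v hv
  -- A vector of `T` outside `u T` generates `T` over `O[ζ]`, so it is cyclic for `ζ` in `V`. An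
  -- endomorphism commuting with `ζ` is then a polynomial in `ζ`, determined by its value at `t`.
  obtain ⟨t, ht, htu⟩ : ∃ t ∈ T, t ∉ u • T := SetLike.not_le_iff_exists.1 (not_le_units_smul hϖ hM)
  let T' : Submodule O V := span O (Set.range fun i : ℕ ↦ (ζ ^ i) t)
  have hζT' : ∀ v ∈ T', ζ v ∈ T' := by
    intro v hv
    induction hv using span_induction with
    | mem v hv =>
      obtain ⟨i, rfl⟩ := hv
      exact subset_span ⟨i + 1, LinearMap.congr_fun (pow_succ' ζ i) t⟩
    | zero => simp
    | add x y _ _ hx hy => rw [map_add]; exact add_mem hx hy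
    | smul a x _ hx =>
      rw [← algebraMap_smul K, map_smul, algebraMap_smul]
      exact Submodule.smul_mem _ _ hx
  have htT' : t ∈ T' := subset_span ⟨0, by simp⟩
  have hTT' : T' = T := by
    -- The set of operators is empty: `T / u T` is already simple over `O`.
    refine eq_of_stable_of_not_le hϖ ∅ (u := u) (by simp) hTl.fg (by simp) hM
      (fun S _ h1 h2 ↦ eq_or_eq_of_irreducible_det huT hdet h1 h2) huT' ?_ (by simp) ?_
      (fun h ↦ htu (h htT'))
    · refine span_le.2 ?_
      rintro _ ⟨i, rfl⟩
      exact pow_apply_mem hζT i t ht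
    · rintro _ ⟨v, hv, rfl⟩
      change (u : Module.End K V) v ∈ T'
      rw [hu]
      exact sub_mem hv (hζT' v hv)
  have hspan : span K (Set.range fun i : ℕ ↦ (ζ ^ i) t) = ⊤ := by
    rw [← span_span_of_tower O, ← hTl.span_eq_top]
    exact congrArg (fun S : Submodule O V ↦ span K (S : Set V)) hTT'
  have hcyc : ∀ v : V, ∃ p : K[X], v = Polynomial.aeval ζ p t := by
    intro v
    have hv : v ∈ span K (Set.range fun i : ℕ ↦ (ζ ^ i) t) := hspan ▸ mem_top
    induction hv using span_induction with
    | mem v hv =>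
      obtain ⟨i, rfl⟩ := hv
      exact ⟨Polynomial.X ^ i, by simp⟩
    | zero => exact ⟨0, by simp⟩
    | add x y _ _ hx hy =>
      obtain ⟨p, rfl⟩ := hx
      obtain ⟨q, rfl⟩ := hy
      exact ⟨p + q, by simp⟩
    | smul a x _ hx =>
      obtain ⟨p, rfl⟩ := hx
      exact ⟨a • p, by simp⟩
  have hpoly := fun (z : Module.End K V) (hz : Commute z ζ) (p : K[X]) ↦ hz.aeval_right p
  obtain ⟨p, hp⟩ := hcyc (x t)
  have hxp : x = Polynomial.aeval ζ p := by
    ext v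
    obtain ⟨q, rfl⟩ := hcyc v
    have h1 : x (Polynomial.aeval ζ q t) = Polynomial.aeval ζ q (x t) :=
      LinearMap.congr_fun (hpoly x hx q) t
    rw [h1, hp, ← Module.End.mul_apply, ← Module.End.mul_apply, ← map_mul, ← map_mul, mul_comm]
  rw [hxp]
  exact (hpoly y hy p).symm

end Submodule

/-! ### Skew-adjoint automorphisms and self-dual lattices. -/

namespace LinearMap.BilinForm

variable {K V : Type*} [Field K] [AddCommGroup V] [Module K V] {f : LinearMap.BilinForm K V}

/-- The integral powers of a skew-adjoint automorphism are adjoint to themselves up to sign. -/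
theorem zpow_smul_eq_or_eq_neg {u : (Module.End K V)ˣ}
    (hu : ∀ x y, f (u • x) y = -f x (u • y)) (i : ℤ) :
    (∀ x y, f (u ^ i • x) y = f x (u ^ i • y)) ∨ ∀ x y, f (u ^ i • x) y = -f x (u ^ i • y) := by
  induction i using Int.induction_on with
  | zero => left; simp
  | succ i ih =>
    rcases ih with ih | ih
    · right
      intro x y
      rw [zpow_add_one, mul_smul, ih, hu, ← mul_smul, (Commute.refl u).zpow_right i |>.eq]
    · left
      intro x y
      rw [zpow_add_one, mul_smul, ih, hu, ← mul_smul, (Commute.refl u).zpow_right i |>.eq, neg_neg]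
  | pred i ih =>
    have hu' : ∀ x y, f (u⁻¹ • x) y = -f x (u⁻¹ • y) := by
      intro x y
      have := hu (u⁻¹ • x) (u⁻¹ • y)
      rw [smul_inv_smul, smul_inv_smul] at this
      rw [this, neg_neg]
    have hcomm : u⁻¹ * u ^ (-(i : ℤ)) = u ^ (-(i : ℤ)) * u⁻¹ :=
      ((Commute.refl u).zpow_right _).inv_left
    rcases ih with ih | ih
    · right
      intro x y
      rw [zpow_sub_one, mul_smul, ih, hu', ← mul_smul, hcomm]
    · left
      intro x y
      rw [zpow_sub_one, mul_smul, ih, hu', ← mul_smul, hcomm, neg_neg]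

end LinearMap.BilinForm

namespace Submodule

variable {O K V : Type*} [CommRing O] [IsDomain O] [IsDiscreteValuationRing O] [Field K]
  [Algebra O K] [IsFractionRing O K] [AddCommGroup V] [Module K V] [Module O V]
  [IsScalarTower O K V]

/-- An automorphism of a lattice has invertible determinant. -/
theorem exists_unit_eq_det (T : Submodule O V) [IsLattice K T] {v : (Module.End K V)ˣ}
    (hv : v • T = T) : ∃ a : Oˣ, algebraMap O K a = LinearMap.det (v : Module.End K V) := by
  have h1 : ∀ x ∈ T, (v : Module.End K V) x ∈ T := fun x hx ↦ by
    rw [← hv]; exact ⟨x, hx, rfl⟩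
  have h2 : ∀ x ∈ T, ((v⁻¹ : (Module.End K V)ˣ) : Module.End K V) x ∈ T := fun x hx ↦ by
    rw [← hv] at hx
    exact (mem_units_smul_iff v T x).1 hx
  have h3 : LinearMap.det (T.restrictEnd _ h1) * LinearMap.det (T.restrictEnd _ h2) = 1 := by
    apply IsFractionRing.injective O K
    rw [map_mul, algebraMap_det_restrictEnd, algebraMap_det_restrictEnd, ← map_mul,
      Units.mul_inv, map_one, map_one]
  exact ⟨Units.mkOfMulEqOne _ _ h3, algebraMap_det_restrictEnd T _ h1⟩

/-- If the determinant of `u` on `T` is a uniformizer, then a lattice `u ^ j T` homothetic to `T`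
by the uniformizer has `j` equal to the rank. -/
theorem eq_finrank_of_smul_eq {ϖ : O} (hϖ : Irreducible ϖ) (T : Submodule O V) [IsLattice K T]
    {u w : (Module.End K V)ˣ} (hu : ∀ v ∈ T, (u : Module.End K V) v ∈ T)
    (hdet : Associated (LinearMap.det (T.restrictEnd (u : Module.End K V) hu)) ϖ)
    (hw : (w : Module.End K V) = algebraMap O K ϖ • LinearMap.id) {j : ℤ}
    (h : w • T = u ^ j • T) : j = Module.finrank K V := by
  -- An automorphism of `T` has a unit as determinant; `det w` has valuation `n`, the rank, and `det
  -- u` has valuation `1`, so `j = n`.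
  have h1 : (w⁻¹ * u ^ j) • T = T := by rw [mul_smul, ← h, inv_smul_smul]
  obtain ⟨a, ha⟩ := exists_unit_eq_det T h1
  obtain ⟨b, hb⟩ := hdet
  have hdu : LinearMap.det (u : Module.End K V) = algebraMap O K ϖ / algebraMap O K b := by
    rw [← algebraMap_det_restrictEnd T _ hu, ← hb, map_mul, mul_div_assoc, div_self, mul_one]
    exact (b.isUnit.map (algebraMap O K)).ne_zero
  have hdw : LinearMap.det (w : Module.End K V) = algebraMap O K ϖ ^ Module.finrank K V := by
    rw [hw, LinearMap.det_smul, LinearMap.det_id, mul_one]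
  set n := Module.finrank K V
  have hϖ0 : algebraMap O K ϖ ≠ 0 := by
    rw [Ne, IsFractionRing.to_map_eq_zero_iff]; exact hϖ.ne_zero
  have hb0 : algebraMap O K b ≠ 0 := (b.isUnit.map (algebraMap O K)).ne_zero
  have h2 : algebraMap O K ϖ ^ j =
      algebraMap O K ϖ ^ n * (algebraMap O K a * algebraMap O K b ^ j) := by
    let D : (Module.End K V)ˣ →* Kˣ := Units.map LinearMap.det
    have h3 : (D (w⁻¹ * u ^ j) : K) = (D w : K)⁻¹ * (D u : K) ^ j := by
      rw [map_mul, map_inv, map_zpow]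
      push_cast
      rfl
    have h4 : (D (w⁻¹ * u ^ j) : K) = algebraMap O K a := ha.symm
    have h5 : (D w : K) = algebraMap O K ϖ ^ n := hdw
    have h6 : (D u : K) = algebraMap O K ϖ / algebraMap O K b := hdu
    rw [h4, h5, h6, div_zpow] at h3
    rw [h3]
    have h7 : algebraMap O K b ^ j ≠ 0 := zpow_ne_zero j hb0
    field_simp
  have h3 : ∃ c : Oˣ, algebraMap O K ϖ ^ j = algebraMap O K ϖ ^ n * algebraMap O K c := by
    refine ⟨a * b ^ j, ?_⟩
    have h8 : algebraMap O K b ^ j = algebraMap O K (b ^ j : Oˣ) := by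
      let φ : Oˣ →* Kˣ := Units.map (algebraMap O K).toMonoidHom
      have h9 : ((φ (b ^ j) : Kˣ) : K) = (φ b : K) ^ j := by
        rw [map_zpow]; push_cast; rfl
      exact h9.symm
    rw [h2, h8, Units.val_mul, map_mul]
  obtain ⟨c, hc⟩ := h3
  have key : ∀ (m : ℕ) (c : Oˣ), algebraMap O K ϖ ^ m = algebraMap O K c → m = 0 := by
    intro m c hm
    rw [← map_pow] at hm
    have h9 : ϖ ^ m = c := IsFractionRing.injective O K hm
    by_contra hm0
    exact hϖ.not_isUnit ((isUnit_pow_iff hm0).1 (h9 ▸ c.isUnit))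
  rcases le_total (n : ℤ) j with hle | hle
  · obtain ⟨m, rfl⟩ := Int.le.dest hle
    rw [zpow_add₀ hϖ0, zpow_natCast, zpow_natCast] at hc
    have := key m c (mul_left_cancel₀ (pow_ne_zero n hϖ0) hc)
    lia
  · obtain ⟨m, hm⟩ := Int.le.dest hle
    rw [← zpow_natCast _ n, ← hm, zpow_add₀ hϖ0, zpow_natCast, mul_assoc] at hc
    have h9 : algebraMap O K ϖ ^ m = algebraMap O K (c⁻¹ : Oˣ) := by
      have h10 := mul_left_cancel₀ (zpow_ne_zero j hϖ0) ((mul_one _).trans hc)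
      have h11 : algebraMap O K c * algebraMap O K (c⁻¹ : Oˣ) = 1 := by
        rw [← map_mul, Units.mul_inv, map_one]
      calc algebraMap O K ϖ ^ m
          = algebraMap O K ϖ ^ m * algebraMap O K c * algebraMap O K (c⁻¹ : Oˣ) := by
            rw [mul_assoc, h11, mul_one]
        _ = _ := by rw [← h10, one_mul]
    have := key m _ h9
    lia

end Submodule

namespace Submodule

variable {O K V : Type*} [CommRing O] [IsDomain O] [IsDiscreteValuationRing O] [Field K]
  [Algebra O K] [IsFractionRing O K] [AddCommGroup V] [Module K V] [Module O V]
  [IsScalarTower O K V]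

/-- If a skew-adjoint automorphism `u` which commutes with `G` acts topologically nilpotently on a
stable lattice, with a uniformizer as determinant, then one of the lattices `u ^ i T` is its own
dual, and so carries a perfect form. -/
theorem exists_perfect_of_skewAdjoint [FiniteDimensional K V] [Nontrivial V] {G : Type*} [Group G]
    {ρ : Representation K G V} {f : LinearMap.BilinForm K V} (hf : f.Nondegenerate)
    (halt : f.IsAlt) (hinv : ∀ (g : G) (x y : V), f (ρ g x) (ρ g y) = f x y) {ϖ : O}
    (hϖ : Irreducible ϖ) {d : ℕ} (hd : Module.finrank K V = 2 * d) (T : Submodule O V)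
    [hTl : IsLattice K T] (hT : ∀ g, ∀ x ∈ T, ρ g x ∈ T) {u : (Module.End K V)ˣ}
    (hskew : ∀ x y, f (u • x) y = -f x (u • y)) (hcomm : ∀ g, Commute (u : Module.End K V) (ρ g))
    (huG : ∀ S : Submodule O V, (∀ g, ∀ x ∈ S, ρ g x ∈ S) → u • S ≤ S)
    (hu : ∀ v ∈ T, (u : Module.End K V) v ∈ T)
    (hdet : Associated (LinearMap.det (T.restrictEnd (u : Module.End K V) hu)) ϖ)
    {M : ℕ} (hM : ∀ x ∈ T, ∃ y ∈ T, u ^ M • x = ϖ • y) :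
    ∃ (T : Submodule O V) (_ : IsLattice K T) (hT : ∀ (g : G), ∀ x ∈ T, ρ g x ∈ T)
      (f' : LinearMap.BilinForm O T), f'.IsPerfPair ∧ f'.IsAlt ∧
        ∀ (g : G) (x y : T), f' ⟨ρ g x, hT g x x.2⟩ ⟨ρ g y, hT g y y.2⟩ = f' x y := by
  have hdual := isLattice_dualSubmodule hf T
  have hirr := hdet.symm.irreducible hϖ
  have huT : u • T ≤ T := huG T hT
  have hmax : ∀ S : Submodule O V, u • T ≤ S → S ≤ T → S = u • T ∨ S = T :=
    fun S h1 h2 ↦ eq_or_eq_of_irreducible_det hu hirr h1 h2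
  have hchain : ∀ (T' : Submodule O V) [IsLattice K T'], u • T' ≤ T' → ∃ i : ℤ, T' = u ^ i • T :=
    fun T' _ h ↦ exists_eq_zpow_smul hϖ ∅ (by simp) (by simp) hM (fun S _ ↦ hmax S) huT (by simp) h
  have hzcomm : ∀ (i : ℤ) g x, ρ g (u ^ i • x) = u ^ i • ρ g x := fun i g x ↦
    LinearMap.congr_fun ((hcomm g).symm.units_zpow_right i) x
  have hmem : ∀ (i : ℤ) x y, f (u ^ i • x) y ∈ (1 : Submodule O K) ↔
      f x (u ^ i • y) ∈ (1 : Submodule O K) := by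
    intro i x y
    rcases LinearMap.BilinForm.zpow_smul_eq_or_eq_neg hskew i with h | h
    · rw [h]
    · rw [h, neg_mem_iff]
  -- Powers of `u` move across the form up to sign, so the dual of `u ^ s T` is `u ^ (c - s) T`; for
  -- `c = 2 s` it is `u ^ s T` again.
  obtain ⟨c, hc⟩ := hchain (f.dualSubmodule T)
    (huG _ fun g x hx ↦ apply_mem_dualSubmodule hinv hT g hx)
  obtain ⟨s, hs⟩ | ⟨s, hs⟩ := Int.even_or_odd c
  · refine exists_perfect_of_dualSubmodule_eq hf halt hinv (u ^ s • T) ?_ ?_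
    · rintro g _ ⟨x, hx, rfl⟩
      exact ⟨ρ g x, hT g x hx, (hzcomm s g x).symm⟩
    · ext x
      have h1 : x ∈ f.dualSubmodule (u ^ s • T) ↔ u ^ s • x ∈ f.dualSubmodule T := by
        rw [LinearMap.BilinForm.mem_dualSubmodule, LinearMap.BilinForm.mem_dualSubmodule]
        constructor
        · intro h y hy
          rw [hmem]
          exact h _ ⟨y, hy, rfl⟩
        · rintro h _ ⟨y, hy, rfl⟩
          have := h y hy
          rwa [hmem] at this
      rw [h1, hc, hs, zpow_add, mul_smul, mem_units_smul_iff, inv_smul_smul]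
  -- With `j = 2 d` one has `u ^ j T = ϖ T`, so modulo `ϖ` the pairing `f (u ^ c x) (u ^ (j - 1) y)`
  -- depends only on `x` and `y` modulo `u T`. On this line over the residue field it vanishes at
  -- `(t, t)`, hence identically. By duality `u ^ (j - 1) T ⊆ u ^ j T`, which is absurd.
  · exfalso
    -- the homothetic lattice
    have hϖ0 : algebraMap O K ϖ ≠ 0 := by
      rw [Ne, IsFractionRing.to_map_eq_zero_iff]; exact hϖ.ne_zero
    let w : (Module.End K V)ˣ :=
      Units.map (algebraMap K (Module.End K V)).toMonoidHom (Units.mk0 _ hϖ0)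
    have hw : ∀ x : V, w • x = ϖ • x := fun x ↦ algebraMap_smul K ϖ x
    have huw : ∀ x : V, u • ϖ • x = ϖ • u • x := fun x ↦ smul_comm _ _ _
    obtain ⟨j, hj⟩ := hchain (w • T) (by
      rintro _ ⟨_, ⟨x, hx, rfl⟩, rfl⟩
      refine ⟨u • x, huT ⟨x, hx, rfl⟩, ?_⟩
      change w • u • x = u • w • x
      rw [hw, hw, huw])
    have hj' : j = (2 * d : ℕ) := hd ▸ eq_finrank_of_smul_eq hϖ T hu hdet rfl hj
    obtain ⟨t, ht, htu⟩ : ∃ t ∈ T, t ∉ u • T :=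
      SetLike.not_le_iff_exists.1 (not_le_units_smul hϖ hM)
    have hdecomp : ∀ x ∈ T, ∃ a : O, ∃ y ∈ T, x = a • t + u • y := by
      have h1 : span O {t} ⊔ u • T = T := by
        refine (hmax _ le_sup_right (sup_le ?_ huT)).resolve_left fun h ↦ htu ?_
        · rwa [span_singleton_le_iff_mem]
        · rw [← h]
          exact mem_sup_left (mem_span_singleton_self t)
      intro x hx
      rw [← h1] at hx
      obtain ⟨_, ha, _, ⟨y, hy, rfl⟩, rfl⟩ := mem_sup.1 hx
      obtain ⟨a, rfl⟩ := mem_span_singleton.1 ha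
      exact ⟨a, y, hy, rfl⟩
    -- the form takes values in the maximal ideal
    have hval : ∀ x ∈ T, ∀ y ∈ T, ∃ a : O, f (u ^ c • x) (u ^ j • y) = algebraMap O K (ϖ * a) := by
      intro x hx y hy
      have h1 : u ^ j • y ∈ w • T := hj ▸ ⟨y, hy, rfl⟩
      obtain ⟨z, hz, hzy⟩ := h1
      have h2 : u ^ c • x ∈ f.dualSubmodule T := hc ▸ ⟨x, hx, rfl⟩
      obtain ⟨a, ha⟩ := mem_one.1 (h2 z hz)
      refine ⟨a, ?_⟩
      rw [← hzy, map_mul, ha]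
      change f _ (w • z) = _
      rw [hw, ← algebraMap_smul K ϖ z, map_smul, smul_eq_mul]
    -- The sum `c + (j - 1) = 2 (s + d)` is even, so shifting a power of `u` gives `± f z z` with `z
    -- = u ^ (s + d) t`.
    have hzero : f (u ^ c • t) (u ^ (j - 1) • t) = 0 := by
      have h1 : u ^ c • t = u ^ (s + 1 - d) • u ^ (s + d) • t := by
        rw [← mul_smul, ← zpow_add]; congr 2; lia
      have h2 : u ^ (s + 1 - d) • u ^ (j - 1) • t = u ^ (s + d) • t := by
        rw [← mul_smul, ← zpow_add]; congr 2; push_cast at hj'; lia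
      rw [h1]
      rcases LinearMap.BilinForm.zpow_smul_eq_or_eq_neg hskew (s + 1 - d) with h | h
      · rw [h, h2, halt]
      · rw [h, h2, halt, neg_zero]
    have hval' : ∀ x ∈ T, ∀ y ∈ T,
        ∃ a : O, f (u ^ c • x) (u ^ (j - 1) • y) = algebraMap O K (ϖ * a) := by
      intro x hx y hy
      obtain ⟨a, x', hx', rfl⟩ := hdecomp x hx
      obtain ⟨b, y', hy', rfl⟩ := hdecomp y hy
      have huj : ∀ z : V, u ^ (j - 1) • u • z = u ^ j • z := fun z ↦ by
        rw [← mul_smul, ← zpow_add_one, sub_add_cancel]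
      have huj' : ∀ z : V, u • u ^ (j - 1) • z = u ^ j • z := fun z ↦ by
        rw [← mul_smul, ← zpow_one_add, add_sub_cancel]
      have huc : ∀ z : V, u ^ c • u • z = u • u ^ c • z := fun z ↦ by
        rw [← mul_smul, ← mul_smul, ← zpow_add_one, ← zpow_one_add, add_comm]
      obtain ⟨p, hp⟩ := hval t ht y' hy'
      obtain ⟨q, hq⟩ := hval x' hx' (b • t + u • y') hy
      refine ⟨a * p - q, ?_⟩
      have e1 : f (u ^ c • (a • t + u • x')) (u ^ (j - 1) • (b • t + u • y')) =
          algebraMap O K a * f (u ^ c • t) (u ^ (j - 1) • (b • t + u • y')) +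
            f (u • u ^ c • x') (u ^ (j - 1) • (b • t + u • y')) := by
        rw [smul_add (u ^ c), map_add, LinearMap.add_apply, huc, smul_comm (u ^ c) a,
          ← algebraMap_smul K a (u ^ c • t), map_smul f, LinearMap.smul_apply, smul_eq_mul]
      have e2 : f (u ^ c • t) (u ^ (j - 1) • (b • t + u • y')) = algebraMap O K (ϖ * p) := by
        rw [smul_add, map_add, huj, hp, smul_comm _ b, ← algebraMap_smul K b, map_smul, hzero,
          smul_zero, zero_add]
      rw [e1, e2, hskew, huj', hq]
      simp only [map_mul, map_sub]
      ring
    -- contradiction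
    have hle : u ^ (j - 1) • u ^ c • T ≤ w • u ^ c • T := by
      rintro _ ⟨_, ⟨x, hx, rfl⟩, rfl⟩
      change u ^ (j - 1) • u ^ c • x ∈ w • u ^ c • T
      rw [mem_units_smul_iff, ← hc, LinearMap.BilinForm.mem_dualSubmodule]
      intro y hy
      have hwinv : ∀ z : V, w⁻¹ • z = (algebraMap O K ϖ)⁻¹ • z := by
        intro z
        rw [inv_smul_eq_iff, hw, ← algebraMap_smul K ϖ, smul_smul, mul_inv_cancel₀ hϖ0, one_smul]
      obtain ⟨a, ha⟩ := hval' x hx y hy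
      rw [hwinv, map_smul, LinearMap.smul_apply, smul_eq_mul]
      have h1 : (algebraMap O K ϖ)⁻¹ * algebraMap O K (ϖ * a) = algebraMap O K a := by
        rw [map_mul, ← mul_assoc, inv_mul_cancel₀ hϖ0, one_mul]
      rcases LinearMap.BilinForm.zpow_smul_eq_or_eq_neg hskew (j - 1) with h | h
      · rw [h, ha, h1]
        exact mem_one.2 ⟨a, rfl⟩
      · rw [h, ha, mul_neg, h1, neg_mem_iff]
        exact mem_one.2 ⟨a, rfl⟩
    have hwu : w * u ^ c = u ^ c * w := by
      ext x
      change w • u ^ c • x = u ^ c • w • x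
      rw [hw, hw, smul_comm]
    rw [← mul_smul w, hwu, mul_smul, hj, ← mul_smul, ← mul_smul, ← zpow_add, ← zpow_add,
      units_smul_le_iff, ← mul_smul, ← zpow_neg, ← zpow_add] at hle
    have h1 : -(j - 1 + c) + (c + j) = 1 := by ring
    rw [h1, zpow_one] at hle
    exact htu (hle ht)

end Submodule

/-! ### The case of an element of order `ℓ` in the endomorphism algebra. -/

/-- Used with `a = Z ^ (ℓ - 1)`, `b = Z ^ 2`, `c = Z`: it shows `Z - Z⁻¹` as a unit times `1 - Z ^
2`, whose determinant is associated to that of `1 - Z` because `2` is prime to `ℓ`. -/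
theorem neg_mul_one_sub_eq_of_mul_eq {R : Type*} [Ring R] {a b c : R} (h : a * b = c) :
    -a * (1 - b) = c - a := by
  rw [mul_sub, mul_one, neg_mul, h]
  abel

namespace Submodule

variable {O K V : Type*} [CommRing O] [IsDomain O] [IsDiscreteValuationRing O] [Field K]
  [Algebra O K] [IsFractionRing O K] [AddCommGroup V] [Module K V] [Module O V]
  [IsScalarTower O K V]

/-- A faithful irreducible symplectic representation of dimension `2 d` of a finite group of order
divisible by `ℓ > d e + 1`, where `e` is the valuation of `ℓ`, has a stable lattice with a perfect
form if its endomorphism algebra contains an element of order `ℓ`. -/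
theorem exists_perfect_of_exists_orderOf_eq [CharZero K] [FiniteDimensional K V]
    {G : Type*} [Group G] [Finite G]
    {ρ : Representation K G V} (hfaithful : Function.Injective ρ) (hirr : ρ.IsIrreducible)
    {f : LinearMap.BilinForm K V} (hf : f.Nondegenerate)
    (halt : f.IsAlt) (hinv : ∀ (g : G) (x y : V), f (ρ g x) (ρ g y) = f x y) {ϖ : O}
    (hϖ : Irreducible ϖ)
    {ℓ e d : ℕ} (hℓ : ℓ.Prime) (hodd : ℓ ≠ 2) (he : Associated (ℓ : O) (ϖ ^ e)) (he0 : e ≠ 0)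
    (hd : Module.finrank K V = 2 * d) (hlt : d * e + 1 < ℓ) (hcard : ℓ ∣ Nat.card G)
    {ζ₀ : Module.End K V} (hζ₀G : ∀ g, Commute ζ₀ (ρ g)) (hζ₀ : ζ₀ ^ ℓ = 1) (hζ₀1 : ζ₀ ≠ 1) :
    ∃ (T : Submodule O V) (_ : IsLattice K T) (hT : ∀ (g : G), ∀ x ∈ T, ρ g x ∈ T)
      (f' : LinearMap.BilinForm O T), f'.IsPerfPair ∧ f'.IsAlt ∧
        ∀ (g : G) (x y : T), f' ⟨ρ g x, hT g x x.2⟩ ⟨ρ g y, hT g y y.2⟩ = f' x y := by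
  obtain ⟨hnt, -⟩ := (Representation.isIrreducible_iff_forall_stable ρ).1 hirr
  have hdom : ∀ ζ : Module.End K V, (∀ g, Commute ζ (ρ g)) →
      ∀ p q : K[X], Polynomial.aeval ζ p * Polynomial.aeval ζ q = 0 →
      Polynomial.aeval ζ p = 0 ∨ Polynomial.aeval ζ q = 0 := fun ζ hζ p q hpq ↦
    hirr.eq_zero_of_mul_eq_zero (fun g ↦ ((hζ g).symm.aeval_right p).symm) hpq
  -- The only role of `ζ₀`: its centralizer is commutative and contains the image of `G`.
  have hGcomm : ∀ g h, Commute (ρ g) (ρ h) := by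
    intro g h
    refine commute_of_commute O hϖ hℓ hodd he he0 hd hlt hζ₀ hζ₀1 ?_ (hdom ζ₀ hζ₀G)
      (hζ₀G g).symm (hζ₀G h).symm
    refine (hirr.eq_zero_or_isUnit fun g ↦ (Commute.one_left _).sub_left (hζ₀G g)).resolve_left ?_
    exact fun h ↦ hζ₀1 (sub_eq_zero.1 h).symm
  have := Fact.mk hℓ
  -- Unlike `ζ₀`, an element of `G` preserves every `G`-stable lattice, the dual included, and has
  -- its inverse as adjoint, so that `σ - σ⁻¹` is skew-adjoint.
  obtain ⟨σ, hσ⟩ := exists_prime_orderOf_dvd_card' ℓ hcard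
  set ζ := ρ σ with hζdef
  have hζ : ζ ^ ℓ = 1 := by rw [hζdef, ← map_pow, ← hσ, pow_orderOf_eq_one, map_one]
  have hζ1 : ζ ≠ 1 := by
    intro h1
    have h2 : σ = 1 := hfaithful (by rw [map_one]; exact h1)
    rw [h2, orderOf_one] at hσ
    exact hℓ.one_lt.ne hσ
  have hζinv : ρ σ⁻¹ = ζ ^ (ℓ - 1) := by
    have h1 : σ⁻¹ = σ ^ (ℓ - 1) := by
      rw [inv_eq_iff_mul_eq_one, ← pow_succ', Nat.sub_add_cancel hℓ.one_lt.le, ← hσ,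
        pow_orderOf_eq_one]
    rw [h1, map_pow]
  have hucomm : ∀ g, Commute (ρ σ - ρ σ⁻¹) (ρ g) := fun g ↦ (hGcomm σ g).sub_left (hGcomm σ⁻¹ g)
  have hodd' := hℓ.odd_of_ne_two hodd
  obtain ⟨u, hu⟩ : IsUnit (ρ σ - ρ σ⁻¹) := by
    refine (hirr.eq_zero_or_isUnit hucomm).resolve_left fun h0 ↦ hζ1 ?_
    have h1 : ζ = ρ σ⁻¹ := sub_eq_zero.1 h0
    have h2 : ζ ^ 2 = 1 := by
      rw [sq]
      nth_rewrite 2 [h1]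
      exact ρ.apply_mul_apply_inv σ
    obtain ⟨k, hk⟩ := hodd'
    rwa [hk, pow_add, pow_mul, h2, one_pow, one_mul, pow_one] at hζ
  obtain ⟨T, hTl, hT⟩ := exists_isLattice_stable O ρ
  have hζT : ∀ v ∈ T, ζ v ∈ T := hT σ
  have huG : ∀ S : Submodule O V, (∀ g, ∀ x ∈ S, ρ g x ∈ S) →
      ∀ x ∈ S, (u : Module.End K V) x ∈ S := by
    intro S hS x hx
    rw [hu]
    exact sub_mem (hS σ x hx) (hS σ⁻¹ x hx)
  have hϖℓ : ϖ ∣ (ℓ : O) := (dvd_pow_self ϖ he0).trans he.symm.dvd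
  have hZ := restrictEnd_pow_eq_one hζT hζ
  refine exists_perfect_of_skewAdjoint hf halt hinv hϖ hd T hT (u := u) ?_
    (fun g ↦ hu ▸ hucomm g) ?_ (huG T hT) ?_ (exists_pow_smul_eq_of_eq_sub hζT hℓ hodd hϖℓ hζ
      (a := 1) (b := ℓ - 1) (by rw [hu, hζinv, pow_one]))
  · intro x y
    have h1 : ∀ (g : G) (x y : V), f (ρ g x) y = f x (ρ g⁻¹ y) := by
      intro g x y
      rw [← hinv g x, ← Module.End.mul_apply, ρ.apply_mul_apply_inv, Module.End.one_apply]
    change f ((u : Module.End K V) x) y = -f x ((u : Module.End K V) y)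
    rw [hu, LinearMap.sub_apply, LinearMap.sub_apply, map_sub, map_sub, LinearMap.sub_apply, h1, h1,
      inv_inv, neg_sub]
  · rintro S hS _ ⟨x, hx, rfl⟩
    exact huG S hS x hx
  · have hass := associated_det_one_sub hϖ hℓ he he0 hd hlt T hζT hζ hζ1 (hdom ζ (hGcomm σ))
    set Z := T.restrictEnd ζ hζT
    have h1 : T.restrictEnd (u : Module.End K V) (huG T hT) = -Z ^ (ℓ - 1) * (1 - Z ^ 2) := by
      have h2 : Z ^ (ℓ - 1) * Z ^ 2 = Z := by
        rw [← pow_add, show ℓ - 1 + 2 = ℓ + 1 by have := hℓ.two_le; lia, pow_succ, hZ, one_mul]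
      have h3 : -Z ^ (ℓ - 1) * (1 - Z ^ 2) = Z - Z ^ (ℓ - 1) := by
        exact neg_mul_one_sub_eq_of_mul_eq h2
      rw [h3]
      ext v
      rw [coe_restrictEnd_apply, LinearMap.sub_apply, AddSubgroupClass.coe_sub,
        coe_restrictEnd_pow_apply, coe_restrictEnd_apply, hu, hζinv, LinearMap.sub_apply]
    rw [h1, map_mul]
    have h4 : IsUnit (LinearMap.det (-Z ^ (ℓ - 1))) := by
      have h5 : IsUnit Z := (isUnit_pow_iff hℓ.ne_zero).1 (hZ ▸ isUnit_one)
      exact ((h5.pow (ℓ - 1)).neg).map LinearMap.det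
    refine Associated.trans ?_ hass
    refine (associated_unit_mul_left _ _ h4).trans ?_
    refine LinearMap.associated_det_one_sub_pow hℓ.one_lt hZ ?_
    exact (Nat.coprime_two_left.2 hodd')

end Submodule

/-! ### The valuation ring: discreteness and completeness. -/

namespace Valuation

variable {K : Type*} [Field K] {v : Valuation K ℤᵐ⁰}

theorem associated_of_eq {x y : v.valuationSubring} (h : v (x : K) = v (y : K)) :
    Associated x y := by
  by_cases hy : (y : K) = 0
  · have hx : (x : K) = 0 := by rwa [hy, map_zero, map_eq_zero] at h
    rw [Subtype.ext (hx.trans hy.symm)]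
  · have hx : (x : K) ≠ 0 := by
      intro hx
      rw [hx, map_zero, eq_comm, map_eq_zero] at h
      exact hy h
    have hv : v (x : K) ≠ 0 := (map_ne_zero v).2 hx
    refine associated_of_dvd_dvd ⟨⟨y / x, ?_⟩, ?_⟩ ⟨⟨x / y, ?_⟩, ?_⟩
    · rw [mem_valuationSubring_iff, map_div₀, ← h, div_self hv]
    · ext
      change (y : K) = x * (y / x)
      field_simp
    · rw [mem_valuationSubring_iff, map_div₀, h, div_self (h ▸ hv)]
    · ext
      change (x : K) = y * (x / y)
      field_simp

/-- The valuation ring of a normalized discrete valuation is a discrete valuation ring, in which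
the elements of valuation one are irreducible. -/
theorem isDiscreteValuationRing_of_surjective (hv : Function.Surjective v) :
    IsDiscreteValuationRing v.valuationSubring ∧
      ∃ ϖ : v.valuationSubring, Irreducible ϖ ∧ v (ϖ : K) = WithZero.exp (-1 : ℤ) := by
  obtain ⟨p, hp⟩ := hv (WithZero.exp (-1 : ℤ))
  have hple : v p ≤ 1 := by
    rw [hp, ← WithZero.exp_zero, WithZero.exp_le_exp]; lia
  let ϖ : v.valuationSubring := ⟨p, hple⟩
  have hvpow : ∀ n : ℕ, v ((ϖ ^ n : v.valuationSubring) : K) = WithZero.exp (-(n : ℤ)) := by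
    intro n
    change v (p ^ n) = _
    rw [map_pow, hp, ← WithZero.exp_nsmul]
    simp
  have hval : ∀ x : v.valuationSubring, x ≠ 0 → ∃ n : ℕ, v (x : K) = WithZero.exp (-(n : ℤ)) := by
    intro x hx
    have hx0 : v (x : K) ≠ 0 := (map_ne_zero v).2 fun h ↦ hx (Subtype.ext h)
    have h1 : v (x : K) ≤ 1 := x.2
    refine ⟨(-WithZero.log (v (x : K))).toNat, ?_⟩
    have h2 : WithZero.log (v (x : K)) ≤ 0 := by
      rw [← WithZero.exp_log hx0, ← WithZero.exp_zero, WithZero.exp_le_exp] at h1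
      exact h1
    rw [Int.toNat_of_nonneg (by lia), neg_neg, WithZero.exp_log hx0]
  have hunit : ∀ x : v.valuationSubring, IsUnit x ↔ v (x : K) = 1 := by
    intro x
    constructor
    · intro h
      obtain ⟨y, hy⟩ := h.exists_right_inv
      have h2 : v (x : K) * v (y : K) = 1 := by
        rw [← map_mul, ← map_one v]
        exact congrArg (fun z : v.valuationSubring ↦ v (z : K)) hy
      refine le_antisymm x.2 ?_
      calc (1 : ℤᵐ⁰) = v (x : K) * v (y : K) := h2.symm
        _ ≤ v (x : K) * 1 := mul_le_mul_right y.2 _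
        _ = v (x : K) := mul_one _
    · intro h
      exact associated_one_iff_isUnit.1 (associated_of_eq (by rw [h]; exact (map_one v).symm))
  have hirr : Irreducible ϖ := by
    refine ⟨?_, fun {a b} hab ↦ ?_⟩
    · rw [hunit]
      change v p ≠ 1
      rw [hp, ← WithZero.exp_zero, Ne, WithZero.exp_inj]
      lia
    · have hab' : v (a : K) * v (b : K) = WithZero.exp (-1 : ℤ) := by
        rw [← map_mul, ← hp]
        exact congrArg (fun z : v.valuationSubring ↦ v (z : K)) hab.symm
      have ha : a ≠ 0 := by rintro rfl; simp at hab'; exact WithZero.exp_ne_zero hab'.symm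
      have hb : b ≠ 0 := by rintro rfl; simp at hab'; exact WithZero.exp_ne_zero hab'.symm
      obtain ⟨m, hm⟩ := hval a ha
      obtain ⟨n, hn⟩ := hval b hb
      rw [hm, hn, ← WithZero.exp_add, WithZero.exp_inj] at hab'
      rw [hunit, hunit, hm, hn, ← WithZero.exp_zero, WithZero.exp_inj, WithZero.exp_inj]
      lia
  refine ⟨IsDiscreteValuationRing.ofHasUnitMulPowIrreducibleFactorization ⟨ϖ, hirr, fun {x} hx ↦ ?_⟩,
    ϖ, hirr, hp⟩
  obtain ⟨n, hn⟩ := hval x hx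
  exact ⟨n, associated_of_eq ((hvpow n).trans hn.symm)⟩

end Valuation

/-- The valuation ring of a complete discretely valued field is complete. -/
theorem Valued.exists_limit_of_pow_dvd {K : Type*} [Field K] [Valued K ℤᵐ⁰] [CompleteSpace K]
    {ϖ : (Valued.v : Valuation K ℤᵐ⁰).valuationSubring}
    (hϖ : Valued.v (ϖ : K) = WithZero.exp (-1 : ℤ))
    (a : ℕ → (Valued.v : Valuation K ℤᵐ⁰).valuationSubring)
    (ha : ∀ n, ϖ ^ n ∣ a (n + 1) - a n) : ∃ L, ∀ n, ϖ ^ n ∣ L - a n := by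
  have hpow : ∀ n : ℕ, Valued.v ((ϖ : K) ^ n) = WithZero.exp (-(n : ℤ)) := by
    intro n
    rw [map_pow, hϖ, ← WithZero.exp_nsmul]
    simp
  have hϖ0 : (ϖ : K) ≠ 0 := by
    intro h
    rw [h, map_zero] at hϖ
    exact WithZero.exp_ne_zero hϖ.symm
  have hdvd : ∀ n k, ϖ ^ n ∣ a (n + k) - a n := by
    intro n k
    induction k with
    | zero => simp
    | succ k ih =>
      have h1 := (pow_dvd_pow ϖ (Nat.le_add_right n k)).trans (ha (n + k))
      have h2 := dvd_add h1 ih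
      rwa [sub_add_sub_cancel] at h2
  have hle : ∀ n m, n ≤ m → Valued.v ((a m : K) - a n) ≤ WithZero.exp (-(n : ℤ)) := by
    intro n m hnm
    obtain ⟨k, rfl⟩ := Nat.exists_eq_add_of_le hnm
    obtain ⟨r, hr⟩ := hdvd n k
    have h1 : (a (n + k) : K) - a n = ϖ ^ n * r := congrArg Subtype.val hr
    rw [h1, map_mul, hpow]
    calc _ ≤ WithZero.exp (-(n : ℤ)) * 1 := mul_le_mul_right r.2 _
      _ = _ := mul_one _
  have hcauchy : CauchySeq fun n ↦ (a n : K) := by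
    rw [CauchySeq, Valued.cauchy_iff]
    refine ⟨inferInstance, fun γ ↦ ?_⟩
    obtain ⟨n, hn⟩ : ∃ n : ℕ, WithZero.exp (-(n : ℤ)) <
        MonoidWithZeroHom.ValueGroup₀.embedding γ.1 := by
      have h0 : MonoidWithZeroHom.ValueGroup₀.embedding γ.1 ≠ 0 := (map_ne_zero _).2 γ.ne_zero
      refine ⟨(-WithZero.log (MonoidWithZeroHom.ValueGroup₀.embedding γ.1)).toNat + 1, ?_⟩
      rw [← WithZero.lt_log_iff_exp_lt h0]
      lia
    refine ⟨(fun n ↦ (a n : K)) '' Set.Ici n, Filter.image_mem_map (Filter.Ici_mem_atTop n), ?_⟩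
    rintro _ ⟨m, hm, rfl⟩ _ ⟨m', hm', rfl⟩
    rw [Valuation.restrict_lt_iff_lt_embedding]
    refine lt_of_le_of_lt ?_ hn
    have h1 : (a m' : K) - a m = (a m' - a n) - (a m - a n) := by ring
    change Valued.v ((a m' : K) - a m) ≤ _
    rw [h1]
    exact (Valuation.map_sub _ _ _).trans (max_le (hle n m' hm') (hle n m hm))
  obtain ⟨L, hL⟩ := cauchySeq_tendsto_of_complete hcauchy
  have hclosed := Valued.isClosed_valuationSubring K
  have hLO : L ∈ (Valued.v : Valuation K ℤᵐ⁰).valuationSubring :=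
    hclosed.mem_of_tendsto hL (Filter.Eventually.of_forall fun n ↦ (a n).2)
  refine ⟨⟨L, hLO⟩, fun n ↦ ?_⟩
  -- Divisibility passes to the limit because the quotients by `ϖ ^ n` eventually lie in the
  -- valuation ring, which is closed.
  have h2 : Filter.Tendsto (fun m ↦ ((a m : K) - a n) / (ϖ : K) ^ n) Filter.atTop
      (nhds ((L - a n) / (ϖ : K) ^ n)) := (hL.sub_const _).div_const _
  have h3 : (L - a n) / (ϖ : K) ^ n ∈ (Valued.v : Valuation K ℤᵐ⁰).valuationSubring := by
    refine hclosed.mem_of_tendsto h2 ?_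
    filter_upwards [Filter.Ici_mem_atTop n] with m hm
    obtain ⟨k, rfl⟩ := Nat.exists_eq_add_of_le hm
    obtain ⟨r, hr⟩ := hdvd n k
    have h1 : (a (n + k) : K) - a n = ϖ ^ n * r := congrArg Subtype.val hr
    rw [h1, mul_div_cancel_left₀ _ (pow_ne_zero n hϖ0)]
    exact r.2
  refine ⟨⟨_, h3⟩, Subtype.ext ?_⟩
  change L - a n = (ϖ : K) ^ n * ((L - a n) / (ϖ : K) ^ n)
  rw [mul_div_cancel₀ _ (pow_ne_zero n hϖ0)]

/-! ### Assembly of the two cases. -/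

theorem theorem4p2
    -- `K` is a complete discrete valuation field with normalized valuation (the additive value `n`
    -- is written `exp (-n)`), of characteristic zero and residue characteristic `ℓ`, `e = e(K)`
    {K : Type*} [Field K] [CharZero K] [Valued K ℤᵐ⁰] [CompleteSpace K]
    (hv : Function.Surjective (Valued.v : Valuation K ℤᵐ⁰))
    (ℓ : ℕ) [CharP (IsLocalRing.ResidueField (Valued.v : Valuation K ℤᵐ⁰).valuationSubring) ℓ]
    (e : ℕ) (he : (Valued.v : Valuation K ℤᵐ⁰) (ℓ : K) = WithZero.exp (-(e : ℤ)))
    -- `G` satisfies `(D_ℓ)`, and `K[N]` is quasisplit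
    {G : Type*} [Group G] (N : Subgroup G) [N.Normal] (hG : SatisfiesDVia ℓ G N)
    (hN : IsQuasisplit K (MonoidAlgebra K N))
    -- `V` is a `2d`-dimensional faithful simple symplectic `K[G]`-module
    {V : Type*} [AddCommGroup V] [Module K V] [FiniteDimensional K V]
    (d : ℕ) (hd : Module.finrank K V = 2 * d)
    (ρ : Representation K G V) (hfaithful : Function.Injective ρ)
    (hsimple : ρ.IsIrreducible) (hsymp : IsSymplecticRep ρ)
    (hℓ : d * e + 1 < ℓ) :
    ∃ (T : Submodule (Valued.v : Valuation K ℤᵐ⁰).valuationSubring V)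
      (_ : Submodule.IsLattice K T)
      (hT : ∀ (g : G), ∀ x ∈ T, ρ g x ∈ T)
      (f' : LinearMap.BilinForm (Valued.v : Valuation K ℤᵐ⁰).valuationSubring T),
      f'.IsPerfPair ∧ f'.IsAlt ∧
        ∀ (g : G) (x y : T),
          f' ⟨ρ g x, hT g x x.2⟩ ⟨ρ g y, hT g y y.2⟩ = f' x y := by
  let O := (Valued.v : Valuation K ℤᵐ⁰).valuationSubring
  obtain ⟨hdvr, ϖ, hϖ, hvϖ⟩ := Valuation.isDiscreteValuationRing_of_surjective hv
  obtain ⟨f, hf, halt, hinv⟩ := hsymp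
  have hGfin := hG.finite
  have hprime := hG.prime
  obtain ⟨hnt, hstab⟩ := (Representation.isIrreducible_iff_forall_stable ρ).1 hsimple
  have hd0 : 0 < d := by
    have := Module.finrank_pos (R := K) (M := V)
    lia
  have hunit : ∀ n : ℕ, IsUnit (n : O) ↔ ¬ ℓ ∣ n := by
    intro n
    rw [← IsLocalRing.residue_ne_zero_iff_isUnit, map_natCast, Ne, CharP.cast_eq_zero_iff _ ℓ]
  have heϖ : Associated (ℓ : O) (ϖ ^ e) := by
    refine Valuation.associated_of_eq ?_
    change Valued.v (ℓ : K) = Valued.v ((ϖ : K) ^ e)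
    rw [he, map_pow, hvϖ, ← WithZero.exp_nsmul]
    simp
  have he0 : e ≠ 0 := by
    rintro rfl
    rw [pow_zero, associated_one_iff_isUnit, hunit] at heϖ
    exact heϖ dvd_rfl
  -- With `e ≥ 1` and `d ≥ 1` the bound gives `ℓ > d + 1 ≥ 2`, so `ℓ` is odd and does not divide `2
  -- d`.
  have hdℓ : d + 1 < ℓ := by
    have := Nat.le_mul_of_pos_right d (Nat.pos_of_ne_zero he0)
    lia
  have hodd : ℓ ≠ 2 := by lia
  have hdim : ¬ ℓ ∣ Module.finrank K V := by
    rw [hd, hprime.dvd_mul]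
    rintro (h | h)
    · exact hodd ((Nat.prime_dvd_prime_iff_eq hprime Nat.prime_two).1 h)
    · have := Nat.le_of_dvd hd0 h
      lia
  have hcardN : IsUnit (Nat.card N : O) :=
    (hunit _).2 ((hprime.coprime_iff_not_dvd).1 hG.coprime.symm)
  have hirrN : Representation.IsIrreducible (ρ.comp N.subtype) →
      ∃ (T : Submodule O V) (_ : Submodule.IsLattice K T) (hT : ∀ (g : G), ∀ x ∈ T, ρ g x ∈ T)
        (f' : LinearMap.BilinForm O T), f'.IsPerfPair ∧ f'.IsAlt ∧
          ∀ (g : G) (x y : T), f' ⟨ρ g x, hT g x x.2⟩ ⟨ρ g y, hT g y y.2⟩ = f' x y := fun h ↦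
    Submodule.exists_perfect_of_isIrreducible_restrict hf halt hinv N h hϖ
      (Valued.exists_limit_of_pow_dvd hvϖ) hcardN
  rcases hsimple.restrict_or_exists N hG hN hdim with h | ⟨ζ, hζG, hζ, hζ1⟩
  · exact hirrN h
  -- If `N` is all of `G`, the restriction is irreducible anyway. Otherwise `ℓ` divides the index of
  -- `N`, and `G` contains an element of order `ℓ`.
  by_cases htop : N = ⊤
  · refine hirrN ((Representation.isIrreducible_iff_forall_stable _).2
      ⟨hnt, fun W hW ↦ hstab W fun g x hx ↦ ?_⟩)
    exact hW ⟨g, htop ▸ Subgroup.mem_top g⟩ x hx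
  have hcard : ℓ ∣ Nat.card G := by
    have := Fact.mk hprime
    obtain ⟨m, hm⟩ := IsPGroup.iff_card.1 hG.isPGroup
    refine dvd_trans ?_ N.index_dvd_card
    rw [Subgroup.index, hm]
    refine dvd_pow_self ℓ ?_
    rintro rfl
    exact htop (Subgroup.index_eq_one.1 (by rw [Subgroup.index, hm, pow_zero]))
  exact Submodule.exists_perfect_of_exists_orderOf_eq hfaithful hsimple hf halt hinv hϖ hprime hodd
    heϖ he0 hd hℓ hcard hζG hζ hζ1
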